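/- Let $K$ be a field of characteristic $0$ and let $q,\,Q^{1/2}\in K$ be algebraically independent over $\mathbb{Q}$. For integers $a,b,c$ and $u\in K^\times$ write $$\left[\tfrac{a n}{2}+bx+c\right]=\frac{Q^{a/2}u^bq^c-Q^{-a/2}u^{-b}q^{-c}}{q-q^{-1}},\qquad \left\{\tfrac{an}{2}+bx+c\right\}=Q^{a/2}u^bq^c+Q^{-a/2}u^{-b}q^{-c}.$$ Let $A(4)$ be the Birman–Wenzl–Murakami algebra over $K$ on four strands: it is generated by invertible $\sigma_1,\sigma_2,\sigma_3$ satisfying the braid relations and, with $u_i=1-\frac{\sigma_i-\sigma_i^{-1}}{q-q^{-1}}$ and $|i-j|=1$, $$u_iu_j\sigma_i^{\pm1}=u_i\sigma_j^{\mp1},\quad \sigma_i^{\pm1}u_ju_i=\sigma_j^{\mp1}u_i,\quad u_i\sigma_j\sigma_i=u_iu_j,\quad \sigma_i\sigma_ju_i=u_ju_i,$$ $$u_i^2=\delta u_i,\quad \sigma_iu_i=Q^{-1}q\,u_i,\quad u_i\sigma_j^{\pm1}u_i=Q^{\pm1}q^{\mp1}u_i,\qquad \delta=1+\frac{Qq^{-1}-Q^{-1}q}{q-q^{-1}}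 .$$ Put $$R_i(w)=(w-1)q^{-1}\sigma_i-(1-w^{-1})Q^{-1}q\,\sigma_i^{-1}-(q-q^{-1})(Q^{-1}q-q^{-1}),$$ $$(q+q^{-1})E_i=q-\sigma_i+(qQ^{-1}+q^{-1})\frac{u_i}{[n-1]+1},$$ $$S(u)=\frac1{k(u)}\,E_1E_3\,R_2(q^{-2}u^2)R_1(u^2)R_3(u^2)R_2(q^2u^2),$$ $$k(u)=Q^{-2}(q-q^{-1})^8\,[x][x-1][x+n/2][x+n/2-1]^2 .$$ Let $M$ be the irreducible $A(4)$-module labelled by the adjoint representation (the partition $2$), that is, a simple module with $u_3M\neq 0$ on which truncation $u_3M$ the generator $\sigma_1$ acts as $-q^{-1}$. **Proposition.** Such a module $M$ exists, and for every such $M$ the space $E_1E_3M$ has dimension $3$. It has a basis $(e_1,e_2,e_3)$, independent of $u$, with $$u_1e_1=0,\ u_3e_1=\delta e_1,\qquad u_1e_2=\delta e_2,\ u_3e_2=0,\qquad u_1e_3=u_3e_3=0$$ (so $e_1,e_2,e_3$ lie in the parts adjoint$\,\otimes\,$trivial, trivial$\,\otimes\,$adjoint, adjoint$\,\otimes\,$adjoint),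 such that for all $u\in K^\times$ with $k(u)\ne0$ the matrix $B$ of $S(u)$ acting on $E_1E_3M$ in this basis (the $j$-th column holding the coordinates of $S(u)e_j$) satisfies $$P^{-1}BP=\begin{pmatrix}c_{11}&c_{21}&0\\ c_{12}&c_{22}&0\\ 0&0&c_{33}\end{pmatrix},\qquad P=\begin{pmatrix}1&0&1\\1&0&-1\\0&1&0\end{pmatrix},$$ where $$c_{11}=[x+2][x-1][x+n/2-2]+2[2][n/2-2]\frac{\{x+n/2-1\}}{\{n/2-1\}},$$ $$c_{22}=[-x+2][-x-1][-x+n/2-2]+2[2][n/2-2]\frac{\{-x+n/2-1\}}{\{n/2-1\}},$$ $$c_{21}=[2]^2[x][n/2-2],\qquad c_{12}=\frac{2[x][n/2-1]\{n/2\}\{n/2-3\}}{\{n/2-1\}^2},$$ $$c_{33}=-[x+2][x-1][x+n/2-2].$$ Moreover $c_{11}(u)=c_{22}(u^{-1})$ for all $u\in K^\times$. -/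

import Mathlib

universe u v

noncomputable section

namespace BMWFusion

variable {K : Type u} [Field K]

/-- The loop value `1 + (Q q⁻¹ - Q⁻¹ q) / (q - q⁻¹)`, where `Q = t ^ 2`. -/
def loopValue (q t : K) : K := 1 + (t ^ 2 * q⁻¹ - (t ^ 2)⁻¹ * q) / (q - q⁻¹)

/-- The free algebra on symbols `Sum.inl i` (standing for `σ_i`) and `Sum.inr i`
(standing for `σ_i⁻¹`). -/
abbrev Free (K : Type u) [Field K] (r : ℕ) : Type u := FreeAlgebra K (Fin r ⊕ Fin r)

namespace Free

variable {r : ℕ}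

/-- The symbol for `σ_i`. -/
def σ (i : Fin r) : Free K r := FreeAlgebra.ι K (Sum.inl i)

/-- The symbol for `σ_i⁻¹`. -/
def τ (i : Fin r) : Free K r := FreeAlgebra.ι K (Sum.inr i)

/-- `u_i = 1 - (σ_i - σ_i⁻¹) / (q - q⁻¹)`. -/
def U (q : K) (i : Fin r) : Free K r := 1 - (q - q⁻¹)⁻¹ • (σ i - τ i)

end Free

/-- The indices `i`, `j` are neighbours: `j = i ± 1`. -/
def Adjacent {r : ℕ} (i j : Fin r) : Prop := (i : ℕ) + 1 = j ∨ (j : ℕ) + 1 = i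

open Free in
/-- The defining relations of the Birman-Wenzl-Murakami algebra with parameters `q` and
`Q = t ^ 2`, with braid generators `σ_i`, `i : Fin r`. -/
inductive Rel (q t : K) (r : ℕ) : Free K r → Free K r → Prop
  | mul_inv (i : Fin r) : Rel q t r (σ i * τ i) 1
  | inv_mul (i : Fin r) : Rel q t r (τ i * σ i) 1
  | far (i j : Fin r) (hij : i ≠ j) (h : ¬ Adjacent i j) : Rel q t r (σ i * σ j) (σ j * σ i)
  | braid (i j : Fin r) (h : Adjacent i j) : Rel q t r (σ i * σ j * σ i) (σ j * σ i * σ j)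
  | uus (i j : Fin r) (h : Adjacent i j) : Rel q t r (U q i * U q j * σ i) (U q i * τ j)
  | uut (i j : Fin r) (h : Adjacent i j) : Rel q t r (U q i * U q j * τ i) (U q i * σ j)
  | suu (i j : Fin r) (h : Adjacent i j) : Rel q t r (σ i * U q j * U q i) (τ j * U q i)
  | tuu (i j : Fin r) (h : Adjacent i j) : Rel q t r (τ i * U q j * U q i) (σ j * U q i)
  | uss (i j : Fin r) (h : Adjacent i j) : Rel q t r (U q i * σ j * σ i) (U q i * U q j)
  | ssu (i j : Fin r) (h : Adjacent i j) : Rel q t r (σ i * σ j * U q i) (U q j * U q i)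
  | uu (i : Fin r) : Rel q t r (U q i * U q i) (loopValue q t • U q i)
  | su (i : Fin r) : Rel q t r (σ i * U q i) (((t ^ 2)⁻¹ * q) • U q i)
  | usu (i j : Fin r) (h : Adjacent i j) :
      Rel q t r (U q i * σ j * U q i) ((t ^ 2 * q⁻¹) • U q i)
  | utu (i j : Fin r) (h : Adjacent i j) :
      Rel q t r (U q i * τ j * U q i) (((t ^ 2)⁻¹ * q) • U q i)

/-- The Birman-Wenzl-Murakami algebra on `r + 1` strands with parameters `q` and `Q = t ^ 2`. -/
abbrev BMW (q t : K) (r : ℕ) : Type u := RingQuot (Rel q t r)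

/-- The algebra on four strands. -/
abbrev BMW4 (q t : K) : Type u := BMW q t 3

section Elements

variable (q t : K)

/-- The braid generators. The index `i : Fin 3` is the usual index minus one. -/
def sig (i : Fin 3) : BMW4 q t := RingQuot.mkAlgHom K (Rel q t 3) (Free.σ i)

/-- The inverse braid generators. -/
def sigInv (i : Fin 3) : BMW4 q t := RingQuot.mkAlgHom K (Rel q t 3) (Free.τ i)

/-- The elements `u_i = 1 - (σ_i - σ_i⁻¹) / (q - q⁻¹)`. -/
def cupcap (i : Fin 3) : BMW4 q t := 1 - (q - q⁻¹)⁻¹ • (sig q t i - sigInv q t i)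

/-- The bracket `[a (n/2) + b x + c]`, where `q ^ (n/2) = t` (so `Q = q ^ n = t ^ 2`) and
`q ^ x = y`. -/
def br (y : K) (a b c : ℤ) : K :=
  (t ^ a * y ^ b * q ^ c - t ^ (-a) * y ^ (-b) * q ^ (-c)) / (q - q⁻¹)

/-- The brace `{a (n/2) + b x + c}`, with the conventions of `br`. -/
def cu (y : K) (a b c : ℤ) : K :=
  t ^ a * y ^ b * q ^ c + t ^ (-a) * y ^ (-b) * q ^ (-c)

/-- The trigonometric R-matrix `R_i(w)` of the vector representation. -/
def R (i : Fin 3) (w : K) : BMW4 q t :=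
  ((w - 1) * q⁻¹) • sig q t i - ((1 - w⁻¹) * (t ^ 2)⁻¹ * q) • sigInv q t i
    - algebraMap K (BMW4 q t) ((q - q⁻¹) * ((t ^ 2)⁻¹ * q - q⁻¹))

/-- The idempotent `E_i`, determined by
`(q + q⁻¹) E_i = q - σ_i + (q Q⁻¹ + q⁻¹) u_i / ([n - 1] + 1)`. -/
def E (i : Fin 3) : BMW4 q t :=
  (q + q⁻¹)⁻¹ • (algebraMap K (BMW4 q t) q - sig q t i
    + ((q * (t ^ 2)⁻¹ + q⁻¹) / (br q t 1 2 0 (-1) + 1)) • cupcap q t i)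

/-- The normalising factor
`Q⁻² (q - q⁻¹)⁸ [x] [x - 1] [x + n/2] [x + n/2 - 1]²`. -/
def normFactor (y : K) : K :=
  (t ^ 4)⁻¹ * (q - q⁻¹) ^ 8 * (br q t y 0 1 0 * br q t y 0 1 (-1) * br q t y 1 1 0
    * br q t y 1 1 (-1) ^ 2)

/-- The projection onto the fused space: `E_1 E_3` in the usual numbering. -/
def EE : BMW4 q t := E q t 0 * E q t 2

/-- The fused R-matrix: with the usual numbering, `S(y)` is
`k⁻¹ E_1 E_3 R_2(q⁻² y²) R_1(y²) R_3(y²) R_2(q² y²)`. -/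
def S (y : K) : BMW4 q t :=
  (normFactor q t y)⁻¹ • (EE q t * R q t 1 (q⁻¹ ^ 2 * y ^ 2) * R q t 0 (y ^ 2) * R q t 2 (y ^ 2)
    * R q t 1 (q ^ 2 * y ^ 2))

end Elements

/-- `M` is the irreducible representation of the algebra on four strands labelled by the partition
`2`, i.e. by the adjoint representation: `M` is simple, and its truncation `u_3 M`, as a
representation of the algebra on the first two strands, is nonzero and is a multiple of the
one-dimensional representation with `σ_1 = -q⁻¹`. -/
structure IsAdjointComponent (q t : K) (M : Type v) [AddCommGroup M] [Module (BMW4 q t) M] :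
    Prop where
  simple : IsSimpleModule (BMW4 q t) M
  truncation_ne_zero : ∃ m : M, cupcap q t 2 • m ≠ 0
  truncation_eq : ∀ m : M, (sig q t 0 * cupcap q t 2) • m = (algebraMap K (BMW4 q t) (-q⁻¹) *
    cupcap q t 2) • m

section Modules

variable (q t : K) (M : Type v) [AddCommGroup M] [Module K M] [Module (BMW4 q t) M]
  [IsScalarTower K (BMW4 q t) M]

/-- The image `E_1 E_3 M`, on which the fused R-matrix acts. -/
def fusedSpace : Submodule K M := LinearMap.range (Algebra.lsmul K K M (EE q t))

theorem S_smul_mem (y : K) (m : M) : S q t y • m ∈ fusedSpace q t M := by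
  refine ⟨((normFactor q t y)⁻¹ • (R q t 1 (q⁻¹ ^ 2 * y ^ 2) * R q t 0 (y ^ 2) * R q t 2 (y ^ 2)
    * R q t 1 (q ^ 2 * y ^ 2))) • m, ?_⟩
  simp only [Algebra.lsmul_coe, smul_smul, S, mul_smul_comm, mul_assoc]

/-- The action of the fused R-matrix on `E_1 E_3 M`. -/
def fusedAction (y : K) : fusedSpace q t M →ₗ[K] fusedSpace q t M :=
  (Algebra.lsmul K K M (S q t y)).restrict fun m _ => S_smul_mem q t M y m

/-- A basis `(b 0, b 1, b 2)` of `E_1 E_3 M` adapted to the decomposition of each of the two fused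
factors as (adjoint) ⊕ (trivial): `b 0` is of type (adjoint) ⊗ (trivial), `b 1` of type
(trivial) ⊗ (adjoint) and `b 2` of type (adjoint) ⊗ (adjoint). On the trivial summand of the first
factor (strands 1 and 2) `u_1` is the loop value and on the adjoint summand `u_1` is zero;
similarly for `u_3` and the second factor (strands 3 and 4). -/
structure IsAdapted (b : Module.Basis (Fin 3) K (fusedSpace q t M)) : Prop where
  u1_b0 : cupcap q t 0 • (b 0 : M) = 0
  u3_b0 : cupcap q t 2 • (b 0 : M) = loopValue q t • (b 0 : M)
  u1_b1 : cupcap q t 0 • (b 1 : M) = loopValue q t • (b 1 : M)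
  u3_b1 : cupcap q t 2 • (b 1 : M) = 0
  u1_b2 : cupcap q t 0 • (b 2 : M) = 0
  u3_b2 : cupcap q t 2 • (b 2 : M) = 0

end Modules

section Entries

variable (q t y : K)

/-- `[x+2][x-1][x+n/2-2] + 2 [2] [n/2-2] {x+n/2-1} / {n/2-1}` -/
def c11 : K :=
  br q t y 0 1 2 * br q t y 0 1 (-1) * br q t y 1 1 (-2)
    + 2 * br q t y 0 0 2 * br q t y 1 0 (-2) * (cu q t y 1 1 (-1) / cu q t y 1 0 (-1))

/-- `[-x+2][-x-1][-x+n/2-2] + 2 [2] [n/2-2] {-x+n/2-1} / {n/2-1}` -/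
def c22 : K :=
  br q t y 0 (-1) 2 * br q t y 0 (-1) (-1) * br q t y 1 (-1) (-2)
    + 2 * br q t y 0 0 2 * br q t y 1 0 (-2) * (cu q t y 1 (-1) (-1) / cu q t y 1 0 (-1))

/-- `[2]² [x] [n/2-2]` -/
def c21 : K := br q t y 0 0 2 ^ 2 * br q t y 0 1 0 * br q t y 1 0 (-2)

/-- `2 [x] [n/2-1] {n/2} {n/2-3} / {n/2-1}²` -/
def c12 : K :=
  2 * br q t y 0 1 0 * br q t y 1 0 (-1) * cu q t y 1 0 0 * cu q t y 1 0 (-3)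
    / cu q t y 1 0 (-1) ^ 2

/-- `-[x+2][x-1][x+n/2-2]` -/
def c33 : K := -(br q t y 0 1 2 * br q t y 0 1 (-1) * br q t y 1 1 (-2))

end Entries

/-- The matrix used for the change of basis. -/
def P (K : Type u) [Field K] : Matrix (Fin 3) (Fin 3) K :=
  !![1, 0, 1;
     1, 0, -1;
     0, 1, 0]

/-- The block diagonal matrix. -/
def C (q t y : K) : Matrix (Fin 3) (Fin 3) K :=
  !![c11 q t y, c21 q t y, 0;
     c12 q t y, c22 q t y, 0;
     0, 0, c33 q t y]

end BMWFusion

end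

-- In the adjoint module each u_i has rank one, and the commuting σ_1, σ_3 have a joint eigenbasis
-- of six vectors ε_k. Scale it so that u_2 maps onto the line of ∑ ε_k. The module is then encoded
-- by the eigenvalues `alpha`, `beta`, the row `weight` of u_2 and a symmetric matrix `gram`, with
-- σ_2 equal to `gram` times the diagonal matrix of weights. The defining relations become a few
-- identities of rational functions, chiefly `gram_mul_gram` (quadratic relation) and `gram_braid`.
-- This gives a model N, which is simple because the eigenvalue pairs are distinct and all weights
-- are nonzero.
--
-- For an arbitrary M, a truncation vector x generates a submodule of dimension at most six
-- (`exists_submodule_finrank_le`), in any module. Applied to (ε_0, x) in N × M, this yields a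
-- submodule projecting isomorphically onto N; its other projection is a nonzero map N → M of simple
-- modules. So M has the same eigenbasis, with no finiteness assumed beforehand.
--
-- E_1 E_3 projects onto the span of ε_0, ε_1, ε_2, the vectors on which neither σ_1 nor σ_3 has
-- eigenvalue q. The involution `flip`, exchanging σ_1 and σ_3, preserves the coefficients of S(u)
-- and swaps e_1 with e_2. Hence the matrix splits into a block on e_1 + e_2, e_3 and a scalar on
-- e_1 - e_2, and only five entries have to be computed.

universe w

noncomputable section

namespace BMWFusion

/-! ### Structure constants of the adjoint module and their identities -/

section Scalars

variable {K : Type u} [Field K]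

/-- The nonvanishing conditions on `q` and `Q` under which the adjoint representation is defined. -/
structure Generic (q Q : K) : Prop where
  q_ne : q ≠ 0
  Q_ne : Q ≠ 0
  sq_sub_one : q ^ 2 - 1 ≠ 0
  sq_add_one : q ^ 2 + 1 ≠ 0
  sub_one : Q - 1 ≠ 0
  add_one : Q + 1 ≠ 0
  add_sq : Q + q ^ 2 ≠ 0
  sub_sq : Q - q ^ 2 ≠ 0
  mul_sq : q ^ 2 * Q - 1 ≠ 0
  add_pow_six : Q + q ^ 6 ≠ 0

theorem Generic.sub_inv_ne {q Q : K} (h : Generic q Q) : q - q⁻¹ ≠ 0 := by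
  have hq := h.q_ne
  have : q - q⁻¹ = (q ^ 2 - 1) / q := by field_simp
  rw [this]
  exact div_ne_zero h.sq_sub_one hq

theorem Generic.add_inv_ne {q Q : K} (h : Generic q Q) : q + q⁻¹ ≠ 0 := by
  have hq := h.q_ne
  have : q + q⁻¹ = (q ^ 2 + 1) / q := by field_simp
  rw [this]
  exact div_ne_zero h.sq_add_one hq

/-- The weights: in the joint eigenbasis `ε` of `σ_1`, `σ_3`, normalised such that `u_2` maps
onto the line of `∑ ε_k`, one has `u_2 ε_k = weight k • ∑ ε_j`. -/
def weight (q Q : K) : Fin 6 → K :=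
  ![Q * (q ^ 2 - 1) / ((Q + q ^ 2) * (Q - 1)),
    Q * (q ^ 2 - 1) / ((Q + q ^ 2) * (Q - 1)),
    (Q + q ^ 6) * (Q - q ^ 2) * (Q + 1) / (Q * (q ^ 2 - 1) * (q ^ 2 + 1) ^ 2 * (Q + q ^ 2)),
    (Q - q ^ 2) * (Q + q ^ 2) * (q ^ 2 * Q - 1) / (Q * (q ^ 2 - 1) * (q ^ 2 + 1) ^ 2 * (Q - 1)),
    (Q - q ^ 2) * (Q + q ^ 2) * (q ^ 2 * Q - 1) / (Q * (q ^ 2 - 1) * (q ^ 2 + 1) ^ 2 * (Q - 1)),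
    q ^ 2 * (Q + 1) * (q ^ 2 * Q - 1) / (Q * (q ^ 2 - 1) * (q ^ 2 + 1) ^ 2)]

/-- The symmetric matrix with `σ_2 ε_j = ∑ k, (gram k j * weight j) • ε_k`. -/
def gram (q Q : K) : Matrix (Fin 6) (Fin 6) K :=
  let x := q * (q ^ 2 - 1) / (Q - q ^ 2)
  let y := -(q ^ 2 - 1) / (q * (Q + 1))
  let z := (q ^ 2 - 1) / (q * (q ^ 2 * Q - 1))
  let f := (q ^ 2 - 1) * (-(q ^ 2 * Q ^ 2) + (q ^ 2 + 1) * Q - q ^ 4) /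
    (q * (Q - q ^ 2) * (Q + q ^ 2) * (q ^ 2 * Q - 1))
  let g := q * (q ^ 2 - 1) * (-Q ^ 2 + q ^ 2 * (q ^ 2 + 1) * Q - q ^ 2) /
    ((Q - q ^ 2) * (Q + q ^ 2) * (q ^ 2 * Q - 1))
  !![Q / q, -q, -q, 1 / q, -q, 1 / q;
     -q, Q / q, -q, -q, 1 / q, 1 / q;
     -q, -q, q * (q ^ 2 - 1) * (-(q ^ 2 * Q ^ 2) + 2 * (q ^ 6 - q ^ 2) * Q + q ^ 6) /
       ((Q + q ^ 6) * (Q - q ^ 2) * (Q + 1)), x, x, y;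
     1 / q, -q, x, f, g, z;
     -q, 1 / q, x, g, f, z;
     1 / q, 1 / q, y, z, z, -(q ^ 2 - 1) * (Q - q ^ 2) / (q ^ 3 * (Q + 1) * (q ^ 2 * Q - 1))]

/-- The eigenvalues of `σ_1`. -/
def alpha (q Q : K) : Fin 6 → K := ![-q⁻¹, Q⁻¹ * q, -q⁻¹, -q⁻¹, q, q]

/-- The eigenvalues of `σ_3`. -/
def beta (q Q : K) : Fin 6 → K := ![Q⁻¹ * q, -q⁻¹, -q⁻¹, q, -q⁻¹, q]

/-- The permutation of the joint eigenbasis which exchanges `σ_1` and `σ_3`. -/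
def flip : Equiv.Perm (Fin 6) := Equiv.swap 0 1 * Equiv.swap 3 4

variable {q Q : K}

theorem flip_vals : flip 0 = 1 ∧ flip 1 = 0 ∧ flip 2 = 2 ∧ flip 3 = 4 ∧ flip 4 = 3 ∧ flip 5 = 5 := by
  decide

theorem flip_flip (i : Fin 6) : flip (flip i) = i := by
  revert i; decide

theorem alpha_flip (i : Fin 6) : alpha q Q (flip i) = beta q Q i := by
  obtain ⟨h0, h1, h2, h3, h4, h5⟩ := flip_vals
  fin_cases i <;> simp [h0, h1, h2, h3, h4, h5, alpha, beta]

theorem beta_flip (i : Fin 6) : beta q Q (flip i) = alpha q Q i := by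
  rw [← alpha_flip, flip_flip]

theorem weight_flip (i : Fin 6) : weight q Q (flip i) = weight q Q i := by
  obtain ⟨h0, h1, h2, h3, h4, h5⟩ := flip_vals
  fin_cases i <;> simp [h0, h1, h2, h3, h4, h5, weight]

theorem gram_flip (i j : Fin 6) : gram q Q (flip i) (flip j) = gram q Q i j := by
  obtain ⟨h0, h1, h2, h3, h4, h5⟩ := flip_vals
  fin_cases i <;> fin_cases j <;> simp [h0, h1, h2, h3, h4, h5, gram]

theorem gram_symm (i j : Fin 6) : gram q Q i j = gram q Q j i := by
  fin_cases i <;> fin_cases j <;> simp [gram]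

theorem alpha_ne (h : Generic q Q) (i : Fin 6) : alpha q Q i ≠ 0 := by
  have := h.q_ne
  have := h.Q_ne
  fin_cases i <;> simp [alpha, *]

theorem beta_ne (h : Generic q Q) (i : Fin 6) : beta q Q i ≠ 0 := by
  rw [← alpha_flip]
  exact alpha_ne h _

theorem weight_ne (h : Generic q Q) (i : Fin 6) : weight q Q i ≠ 0 := by
  obtain ⟨hq, hQ, h1, h2, h3, h4, h5, h6, h7, h8⟩ := h
  fin_cases i <;> simp [weight, *]

/-- The trace of the rank-one matrix of u_2. It equals the loop value, which gives u_2² = δ u_2. -/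
theorem sum_weight (h : Generic q Q) :
    ∑ k, weight q Q k = (Q + q ^ 2) * (Q - 1) / (Q * (q ^ 2 - 1)) := by
  obtain ⟨hq, hQ, h1, h2, h3, h4, h5, h6, h7, h8⟩ := h
  have h7' : Q * q ^ 2 - 1 ≠ 0 := by rwa [mul_comm]
  simp [Fin.sum_univ_six, weight]
  field_simp
  ring

/-- Expresses σ_2 u_2 = Q⁻¹q u_2: the vector ∑ ε_k is an eigenvector of σ_2. -/
theorem sum_gram_weight (h : Generic q Q) (i : Fin 6) :
    ∑ k, gram q Q i k * weight q Q k = Q⁻¹ * q := by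
  obtain ⟨hq, hQ, h1, h2, h3, h4, h5, h6, h7, h8⟩ := h
  have h7' : Q * q ^ 2 - 1 ≠ 0 := by rwa [mul_comm]
  fin_cases i <;> simp [Fin.sum_univ_six, gram, weight] <;> field_simp <;> ring

/-- Coordinate form of u_2 σ_1 u_2 = Q q⁻¹ u_2. -/
theorem sum_alpha_weight (h : Generic q Q) :
    ∑ k, weight q Q k * alpha q Q k = Q * q⁻¹ := by
  obtain ⟨hq, hQ, h1, h2, h3, h4, h5, h6, h7, h8⟩ := h
  have h7' : Q * q ^ 2 - 1 ≠ 0 := by rwa [mul_comm]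
  simp [Fin.sum_univ_six, alpha, weight]
  field_simp
  ring

/-- Since u_1 is supported on ε_1, this row is all that the mixed relations between u_1 and σ_2 can
see. -/
theorem gram_one (h : Generic q Q) (i : Fin 6) : gram q Q 1 i = (alpha q Q i)⁻¹ := by
  have hq := h.q_ne
  have hQ := h.Q_ne
  fin_cases i <;> simp [gram, alpha, div_eq_mul_inv, mul_comm]

-- The relation σ_2² = 1 + (q - q⁻¹)(σ_2 - Q⁻¹q u_2), with the right-hand factor `weight q Q j`
-- cancelled. Both sides are then symmetric, so the upper triangle suffices.
set_option maxHeartbeats 2000000 in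
theorem gram_mul_gram (h : Generic q Q) (i j : Fin 6) :
    ∑ k, gram q Q i k * weight q Q k * gram q Q k j
      = (q - q⁻¹) * gram q Q i j - (q - q⁻¹) * (Q⁻¹ * q) + if i = j then (weight q Q i)⁻¹ else 0 := by
  wlog hij : i ≤ j generalizing i j
  · have hji := this j i (le_of_not_ge hij)
    rw [show ∑ k, gram q Q i k * weight q Q k * gram q Q k j = ∑ k, gram q Q j k * weight q Q k * gram q Q k i from
      Finset.sum_congr rfl fun k _ => by rw [gram_symm i k, gram_symm k j]; ring, hji, gram_symm j i]
    simp [(lt_of_not_ge hij).ne, (lt_of_not_ge hij).ne']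
  obtain ⟨hq, hQ, h1, h2, h3, h4, h5, h6, h7, h8⟩ := h
  have h7' : Q * q ^ 2 - 1 ≠ 0 := by rwa [mul_comm]
  fin_cases i <;> fin_cases j <;> first
    | exact absurd hij (by decide)
    | simp [Fin.sum_univ_six, gram, weight]
      field_simp
      ring

-- The braid relation σ_2 σ_1 σ_2 = σ_1 σ_2 σ_1 with the last weight cancelled; again symmetric in
-- the two indices.
set_option maxHeartbeats 2000000 in
theorem gram_braid (h : Generic q Q) (i j : Fin 6) :
    ∑ k, gram q Q i k * weight q Q k * alpha q Q k * gram q Q k j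
      = alpha q Q i * gram q Q i j * alpha q Q j := by
  wlog hij : i ≤ j generalizing i j
  · have hji := this j i (le_of_not_ge hij)
    rw [show ∑ k, gram q Q i k * weight q Q k * alpha q Q k * gram q Q k j = ∑ k, gram q Q j k * weight q Q k * alpha q Q k * gram q Q k i from
      Finset.sum_congr rfl fun k _ => by rw [gram_symm i k, gram_symm k j]; ring, hji, gram_symm j i]
    ring
  obtain ⟨hq, hQ, h1, h2, h3, h4, h5, h6, h7, h8⟩ := h
  have h7' : Q * q ^ 2 - 1 ≠ 0 := by rwa [mul_comm]
  fin_cases i <;> fin_cases j <;> first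
    | exact absurd hij (by decide)
    | simp [Fin.sum_univ_six, gram, weight, alpha]
      field_simp
      ring

end Scalars

/-! ### Reduction of the defining relations and the matrix representation -/

section Representation

variable {K : Type u} [Field K]

/-- A family of elements of an algebra satisfying a generating set of the
Birman-Wenzl-Murakami relations. -/
structure BMWSystem {A : Type*} [Ring A] [Algebra K A] (q t : K) {r : ℕ} (s τ e : Fin r → A) :
    Prop where
  skein (i) : s i - τ i = (q - q⁻¹) • (1 - e i)
  mul_inv (i) : s i * τ i = 1
  inv_mul (i) : τ i * s i = 1
  far (i j) (hij : i ≠ j) (h : ¬ Adjacent i j) : s i * s j = s j * s i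
  braid (i j) (h : Adjacent i j) : s i * s j * s i = s j * s i * s j
  ee (i) : e i * e i = loopValue q t • e i
  se (i) : s i * e i = ((t ^ 2)⁻¹ * q) • e i
  eee (i j) (h : Adjacent i j) : e i * e j * e i = e i
  ees (i j) (h : Adjacent i j) : e i * e j * s i = e i * τ j
  see (i j) (h : Adjacent i j) : s i * e j * e i = τ j * e i
  ese (i j) (h : Adjacent i j) : e i * s j * e i = (t ^ 2 * q⁻¹) • e i

theorem Adjacent.symm {r : ℕ} {i j : Fin r} (h : Adjacent i j) : Adjacent j i := Or.symm h

namespace BMWSystem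

variable {A : Type*} [Ring A] [Algebra K A] {q t : K} {r : ℕ} {s τ e : Fin r → A}

theorem inv_eq (H : BMWSystem q t s τ e) (i : Fin r) :
    τ i = s i - (q - q⁻¹) • (1 - e i) := by
  rw [← H.skein i]; abel

/-- The skein relation trades τ for s on both sides of `ees`; the correction terms agree because e_i
e_j e_i = e_i. -/
theorem eet (H : BMWSystem q t s τ e) (i j : Fin r) (h : Adjacent i j) :
    e i * e j * τ i = e i * s j := by
  have h1 := H.ees i j h
  have h2 := H.eee i j h
  rw [H.inv_eq j] at h1
  rw [H.inv_eq i, mul_sub, h1, mul_smul_comm, mul_sub, mul_sub, mul_smul_comm, mul_sub, h2,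
    mul_one, mul_one, smul_sub, smul_sub]
  abel

theorem tee (H : BMWSystem q t s τ e) (i j : Fin r) (h : Adjacent i j) :
    τ i * e j * e i = s j * e i := by
  have h1 := H.see i j h
  have h2 := H.eee i j h
  rw [H.inv_eq j] at h1
  rw [mul_assoc] at h1 h2
  rw [H.inv_eq i, mul_assoc, sub_mul, h1, smul_mul_assoc, sub_mul, sub_mul, smul_mul_assoc,
    sub_mul, h2, one_mul, one_mul, smul_sub, smul_sub]
  abel

/-- The skein relation turns the scalar into Q q⁻¹ - (q - q⁻¹)(δ - 1), and δ is defined so that this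
is Q⁻¹ q. -/
theorem ete (H : BMWSystem q t s τ e) (hz : q - q⁻¹ ≠ 0) (i j : Fin r)
    (h : Adjacent i j) : e i * τ j * e i = ((t ^ 2)⁻¹ * q) • e i := by
  rw [H.inv_eq j, mul_sub, sub_mul, H.ese i j h, mul_smul_comm, smul_mul_assoc, mul_sub, sub_mul,
    H.eee i j h, mul_one, H.ee, smul_sub, smul_smul, ← sub_smul, ← sub_smul]
  congr 1
  rw [← mul_sub_one, loopValue, add_sub_cancel_left, mul_div_cancel₀ _ hz]
  ring

variable (s τ) in
/-- The values on the free algebra. -/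
def freeLift : Free K r →ₐ[K] A := FreeAlgebra.lift K (Sum.elim s τ)

theorem freeLift_σ (i : Fin r) : freeLift s τ (Free.σ i : Free K r) = s i := by
  simp [freeLift, Free.σ]

theorem freeLift_τ (i : Fin r) : freeLift s τ (Free.τ i : Free K r) = τ i := by
  simp [freeLift, Free.τ]

theorem freeLift_U (H : BMWSystem q t s τ e) (hz : q - q⁻¹ ≠ 0) (i : Fin r) :
    freeLift s τ (Free.U q i : Free K r) = e i := by
  simp only [Free.U, map_sub, map_one, map_smul, freeLift_σ, freeLift_τ]
  rw [H.skein i, smul_smul, inv_mul_cancel₀ hz, one_smul, sub_sub_cancel]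

theorem freeLift_rel (H : BMWSystem q t s τ e) (hz : q - q⁻¹ ≠ 0)
    {x y : Free K r} (h : Rel q t r x y) : freeLift s τ x = freeLift s τ y := by
  induction h with
  | mul_inv i => simpa [freeLift_σ, freeLift_τ] using H.mul_inv i
  | inv_mul i => simpa [freeLift_σ, freeLift_τ] using H.inv_mul i
  | far i j hij h => simpa [freeLift_σ] using H.far i j hij h
  | braid i j h => simpa [freeLift_σ] using H.braid i j h
  | uus i j h => simpa [freeLift_σ, freeLift_τ, H.freeLift_U hz] using H.ees i j h
  | uut i j h => simpa [freeLift_σ, freeLift_τ, H.freeLift_U hz] using H.eet i j h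
  | suu i j h => simpa [freeLift_σ, freeLift_τ, H.freeLift_U hz] using H.see i j h
  | tuu i j h => simpa [freeLift_σ, freeLift_τ, H.freeLift_U hz] using H.tee i j h
  | uss i j h =>
    simp only [map_mul, freeLift_σ, H.freeLift_U hz]
    rw [← H.eet i j h, mul_assoc, H.inv_mul, mul_one]
  | ssu i j h =>
    simp only [map_mul, freeLift_σ, H.freeLift_U hz]
    rw [mul_assoc, ← H.tee i j h, ← mul_assoc, ← mul_assoc, H.mul_inv, one_mul]
  | uu i => simpa [H.freeLift_U hz] using H.ee i
  | su i => simpa [freeLift_σ, H.freeLift_U hz] using H.se i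
  | usu i j h => simpa [freeLift_σ, H.freeLift_U hz] using H.ese i j h
  | utu i j h => simpa [freeLift_τ, H.freeLift_U hz] using H.ete hz i j h

/-- The representation given by a system. -/
theorem exists_algHom {s τ e : Fin 3 → A} (H : BMWSystem q t s τ e) (hz : q - q⁻¹ ≠ 0) :
    ∃ f : BMW4 q t →ₐ[K] A, (∀ i, f (sig q t i) = s i) ∧ ∀ i, f (cupcap q t i) = e i := by
  let f : BMW4 q t →ₐ[K] A :=
    RingQuot.liftAlgHom K ⟨freeLift s τ, fun _ _ h => H.freeLift_rel hz h⟩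
  have hs (i) : f (sig q t i) = s i := by
    simp [f, sig, freeLift_σ]
  have hτ (i) : f (sigInv q t i) = τ i := by
    simp [f, sigInv, freeLift_τ]
  refine ⟨f, hs, fun i => ?_⟩
  rw [cupcap, map_sub, map_one, map_smul, map_sub, hs, hτ, H.skein i, smul_smul,
    inv_mul_cancel₀ hz, one_smul, sub_sub_cancel]

end BMWSystem

/-! ### Verification of the relations in 6 × 6 matrices -/

section Matrices

open Matrix

/-- The matrices of `σ_i` in the adjoint representation. -/
def sigMat (q Q : K) : Fin 3 → Matrix (Fin 6) (Fin 6) K :=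
  ![diagonal (alpha q Q), of fun i j => gram q Q i j * weight q Q j, diagonal (beta q Q)]

/-- The matrices of `u_i` in the adjoint representation. -/
def cupMat (q Q : K) : Fin 3 → Matrix (Fin 6) (Fin 6) K :=
  ![diagonal (Pi.single 1 (weight q Q 1)⁻¹), of fun _ j => weight q Q j,
    diagonal (Pi.single 0 (weight q Q 0)⁻¹)]

/-- The matrices of `σ_i⁻¹` in the adjoint representation. -/
def invMat (q Q : K) : Fin 3 → Matrix (Fin 6) (Fin 6) K :=
  ![diagonal (alpha q Q)⁻¹,
    of fun i j => (gram q Q i j - (q - q⁻¹) * ((if i = j then (weight q Q i)⁻¹ else 0) - 1))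
      * weight q Q j,
    diagonal (beta q Q)⁻¹]

/-- Conjugation by the permutation matrix of `flip`. -/
def flipMat : Matrix (Fin 6) (Fin 6) K ≃ₐ[K] Matrix (Fin 6) (Fin 6) K :=
  reindexAlgEquiv K K flip

variable {q Q : K}

theorem flip_symm : flip.symm = flip := by decide

theorem flipMat_apply (M : Matrix (Fin 6) (Fin 6) K) (i j : Fin 6) :
    flipMat M i j = M (flip i) (flip j) := by
  simp [flipMat, flip_symm]

theorem flipMat_diagonal (d : Fin 6 → K) :
    flipMat (diagonal d) = diagonal fun i => d (flip i) := by
  ext i j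
  simp [flipMat_apply, diagonal_apply]

/-- The symmetry of the braid generators under reversing the order of the strands is an algebra
automorphism here, so relations between σ_3 and σ_2 follow from those between σ_1 and σ_2. -/
theorem flipMat_sigMat (i : Fin 3) : flipMat (sigMat q Q i) = sigMat q Q i.rev := by
  fin_cases i
  · simp [sigMat, flipMat_diagonal, alpha_flip]
  · ext i j
    simp [sigMat, flipMat_apply, gram_flip, weight_flip]
  · simp [sigMat, flipMat_diagonal, beta_flip]

theorem flipMat_invMat (i : Fin 3) : flipMat (invMat q Q i) = invMat q Q i.rev := by
  fin_cases i
  · simp [invMat, flipMat_diagonal, alpha_flip, Pi.inv_def]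
  · ext i j
    simp [invMat, flipMat_apply, gram_flip, weight_flip]
  · simp [invMat, flipMat_diagonal, beta_flip, Pi.inv_def]

theorem flipMat_cupMat (i : Fin 3) : flipMat (cupMat q Q i) = cupMat q Q i.rev := by
  obtain ⟨h0, h1, h2, h3, h4, h5⟩ := flip_vals
  fin_cases i
  · refine (flipMat_diagonal _).trans (congrArg diagonal (funext fun i => ?_))
    fin_cases i <;> simp [h0, h1, h2, h3, h4, h5, weight]
  · ext i j
    simp [cupMat, flipMat_apply, weight_flip]
  · refine (flipMat_diagonal _).trans (congrArg diagonal (funext fun i => ?_))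
    fin_cases i <;> simp [h0, h1, h2, h3, h4, h5, weight]

/-- It suffices to check a relation between neighbours for the first two strands. -/
theorem adjacent_cases {p : Fin 3 → Fin 3 → Prop} (h01 : p 0 1) (h10 : p 1 0)
    (hflip : ∀ i j, p i j → p i.rev j.rev) {i j : Fin 3} (h : Adjacent i j) : p i j := by
  have h21 := hflip _ _ h01
  have h12 := hflip _ _ h10
  fin_cases i <;> fin_cases j <;> simp [Adjacent] at h <;> assumption

@[elab_as_elim]
theorem rev_cases {p : Fin 3 → Prop} (h0 : p 0) (h1 : p 1)
    (hflip : ∀ i, p i → p i.rev) (i : Fin 3) : p i := by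
  have h2 := hflip _ h0
  fin_cases i <;> assumption

theorem loopValue_eq {q t : K} (h : Generic q (t ^ 2)) :
    loopValue q t = (t ^ 2 + q ^ 2) * (t ^ 2 - 1) / (t ^ 2 * (q ^ 2 - 1)) := by
  have hz := h.sub_inv_ne
  obtain ⟨hq, hQ, h1, h2, h3, h4, h5, h6, h7, h8⟩ := h
  have ht : t ≠ 0 := fun h => hQ (by simp [h])
  rw [loopValue, ← sub_eq_zero]
  have : q - q⁻¹ = (q ^ 2 - 1) / q := by field_simp
  rw [this]
  field_simp
  ring

/-- Forced by u_1 u_2 u_1 = u_1: with u_1 acting as δ on the line of ε_1, the diagonal coefficient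
of u_2 there must be δ⁻¹. -/
theorem loopValue_eq_inv {q t : K} (h : Generic q (t ^ 2)) :
    loopValue q t = (weight q (t ^ 2) 1)⁻¹ := by
  rw [loopValue_eq h]
  simp [weight]

/-- The values q and -q⁻¹ are the roots of a - a⁻¹ = q - q⁻¹, on which u_1 vanishes; the third
eigenvalue Q⁻¹q, occurring only at index 1, gives u_1 = δ. -/
theorem alpha_skein {q t : K} (h : Generic q (t ^ 2)) (i : Fin 6) :
    alpha q (t ^ 2) i - (alpha q (t ^ 2) i)⁻¹
      = (q - q⁻¹) * (1 - (Pi.single 1 (weight q (t ^ 2) 1)⁻¹ : Fin 6 → K) i) := by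
  have hz := h.sub_inv_ne
  rw [← loopValue_eq_inv h]
  have h1 : (t ^ 2)⁻¹ * q - ((t ^ 2)⁻¹ * q)⁻¹ = (q - q⁻¹) * (1 - loopValue q t) := by
    rw [loopValue, sub_add_cancel_left, mul_neg, mul_div_cancel₀ _ hz, mul_inv, inv_inv]
    ring
  fin_cases i <;> first | exact h1 | simp [alpha]
  all_goals ring

theorem sigMat_sub_invMat {q t : K} (h : Generic q (t ^ 2)) (i : Fin 3) :
    sigMat q (t ^ 2) i - invMat q (t ^ 2) i = (q - q⁻¹) • (1 - cupMat q (t ^ 2) i) := by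
  refine rev_cases ?_ ?_ (fun i h => ?_) i
  · ext i j
    by_cases hij : i = j
    · subst hij
      simpa [sigMat, invMat, cupMat] using alpha_skein h i
    · simp [sigMat, invMat, cupMat, hij]
  · ext i j
    by_cases hij : i = j
    · subst hij
      have := weight_ne h i
      simp [sigMat, invMat, cupMat]
      field_simp
      ring
    · simp [sigMat, invMat, cupMat, hij]
      ring
  · simpa [flipMat_sigMat, flipMat_invMat, flipMat_cupMat] using congrArg flipMat h

theorem sigMat_mul_invMat {q t : K} (h : Generic q (t ^ 2)) (i : Fin 3) :
    sigMat q (t ^ 2) i * invMat q (t ^ 2) i = 1 := by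
  refine rev_cases ?_ ?_ (fun i h => ?_) i
  · ext i j
    have := alpha_ne h i
    by_cases hij : i = j
    · subst hij
      simp [sigMat, invMat, this]
    · simp [sigMat, invMat, hij]
  · ext i j
    have hw := weight_ne h j
    have h1 := gram_mul_gram h i j
    have h2 := sum_gram_weight h i
    -- Expanding the inverse leaves only the sums evaluated by `gram_mul_gram` and
    -- `sum_gram_weight`; their Q⁻¹q terms cancel.
    have key : ∑ k, gram q (t ^ 2) i k * weight q (t ^ 2) k *
        ((gram q (t ^ 2) k j - (q - q⁻¹) * ((if k = j then (weight q (t ^ 2) k)⁻¹ else 0) - 1))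
          * weight q (t ^ 2) j)
        = (∑ k, gram q (t ^ 2) i k * weight q (t ^ 2) k * gram q (t ^ 2) k j
            - (q - q⁻¹) * gram q (t ^ 2) i j
            + (q - q⁻¹) * ∑ k, gram q (t ^ 2) i k * weight q (t ^ 2) k) * weight q (t ^ 2) j := by
      have h3 : gram q (t ^ 2) i j
          = ∑ k, gram q (t ^ 2) i k * weight q (t ^ 2) k *
            (if k = j then (weight q (t ^ 2) k)⁻¹ else 0) := by
        simp [mul_assoc, hw]
      conv_rhs => rw [h3]
      rw [Finset.mul_sum, Finset.mul_sum, ← Finset.sum_sub_distrib, ← Finset.sum_add_distrib,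
        Finset.sum_mul]
      exact Finset.sum_congr rfl fun k _ => by ring
    simp only [sigMat, invMat, mul_apply, of_apply, cons_val]
    rw [key, h1, h2]
    by_cases hij : i = j
    · subst hij
      rw [if_pos rfl, one_apply_eq, ← inv_mul_cancel₀ hw]
      ring
    · simp [hij]
  · simpa [flipMat_sigMat, flipMat_invMat] using congrArg flipMat h

theorem sigMat_far {q t : K} (i j : Fin 3) (hij : i ≠ j) (h : ¬ Adjacent i j) :
    sigMat q (t ^ 2) i * sigMat q (t ^ 2) j = sigMat q (t ^ 2) j * sigMat q (t ^ 2) i := by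
  fin_cases i <;> fin_cases j <;> simp [Adjacent, sigMat, mul_comm] at *

theorem sigMat_braid {q t : K} (h : Generic q (t ^ 2)) {i j : Fin 3} (hij : Adjacent i j) :
    sigMat q (t ^ 2) i * sigMat q (t ^ 2) j * sigMat q (t ^ 2) i
      = sigMat q (t ^ 2) j * sigMat q (t ^ 2) i * sigMat q (t ^ 2) j := by
  have h01 : sigMat q (t ^ 2) 0 * sigMat q (t ^ 2) 1 * sigMat q (t ^ 2) 0
      = sigMat q (t ^ 2) 1 * sigMat q (t ^ 2) 0 * sigMat q (t ^ 2) 1 := by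
    ext i j
    have h1 := gram_braid h i j
    simp only [sigMat, cons_val]
    rw [mul_diagonal, diagonal_mul, mul_apply]
    simp only [mul_diagonal, of_apply]
    rw [show alpha q (t ^ 2) i * (gram q (t ^ 2) i j * weight q (t ^ 2) j) * alpha q (t ^ 2) j
      = alpha q (t ^ 2) i * gram q (t ^ 2) i j * alpha q (t ^ 2) j * weight q (t ^ 2) j by ring,
      ← h1, Finset.sum_mul]
    exact Finset.sum_congr rfl fun k _ => by ring
  refine adjacent_cases (p := fun i j => sigMat q (t ^ 2) i * sigMat q (t ^ 2) j *
    sigMat q (t ^ 2) i = sigMat q (t ^ 2) j * sigMat q (t ^ 2) i * sigMat q (t ^ 2) j)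
    h01 h01.symm (fun i j h => ?_) hij
  simpa [flipMat_sigMat] using congrArg flipMat h

theorem cupMat_mul_self {q t : K} (h : Generic q (t ^ 2)) (i : Fin 3) :
    cupMat q (t ^ 2) i * cupMat q (t ^ 2) i = loopValue q t • cupMat q (t ^ 2) i := by
  rw [loopValue_eq_inv h]
  refine rev_cases ?_ ?_ (fun i h => ?_) i
  · simp [cupMat, ← diagonal_smul, ← Pi.single_smul, Pi.single_apply]
    exact fun i h1 h2 => absurd h2 h1
  · ext i j
    rw [← loopValue_eq_inv h, loopValue_eq h, ← sum_weight h]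
    simp [cupMat, mul_apply, Finset.sum_mul]
  · simpa [flipMat_cupMat] using congrArg flipMat h

theorem sigMat_mul_cupMat {q t : K} (h : Generic q (t ^ 2)) (i : Fin 3) :
    sigMat q (t ^ 2) i * cupMat q (t ^ 2) i = ((t ^ 2)⁻¹ * q) • cupMat q (t ^ 2) i := by
  refine rev_cases ?_ ?_ (fun i h => ?_) i
  · simp only [cupMat, sigMat, cons_val, diagonal_mul_diagonal, ← diagonal_smul, ← Pi.single_smul]
    congr 1
    ext i
    fin_cases i <;> simp [alpha]
  · ext i j
    have := sum_gram_weight h i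
    simp [cupMat, sigMat, mul_apply, ← Finset.sum_mul, this]
  · simpa [flipMat_sigMat, flipMat_cupMat] using congrArg flipMat h

theorem cupMat_cupMat_cupMat {q t : K} (h : Generic q (t ^ 2)) {i j : Fin 3} (hij : Adjacent i j) :
    cupMat q (t ^ 2) i * cupMat q (t ^ 2) j * cupMat q (t ^ 2) i = cupMat q (t ^ 2) i := by
  have hw := weight_ne h 1
  refine adjacent_cases (p := fun i j => cupMat q (t ^ 2) i * cupMat q (t ^ 2) j *
    cupMat q (t ^ 2) i = cupMat q (t ^ 2) i) ?_ ?_ (fun i j h => ?_) hij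
  · ext i j
    simp only [cupMat, cons_val, diagonal_mul, mul_diagonal, of_apply, diagonal_apply]
    by_cases hi : i = 1 <;> by_cases hj : j = 1 <;> by_cases hh : i = j <;>
      simp_all
  · ext i j
    simp [cupMat, mul_apply, Pi.single_apply, hw, diagonal_apply]
  · simpa [flipMat_cupMat] using congrArg flipMat h

/-- For u_1 on the left only row 1 survives, where `gram_one` turns the claim into the skein
relation for a single eigenvalue of σ_1. -/
theorem cupMat_cupMat_sigMat {q t : K} (h : Generic q (t ^ 2)) {i j : Fin 3} (hij : Adjacent i j) :
    cupMat q (t ^ 2) i * cupMat q (t ^ 2) j * sigMat q (t ^ 2) i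
      = cupMat q (t ^ 2) i * invMat q (t ^ 2) j := by
  have hw := weight_ne h 1
  refine adjacent_cases (p := fun i j => cupMat q (t ^ 2) i * cupMat q (t ^ 2) j *
    sigMat q (t ^ 2) i = cupMat q (t ^ 2) i * invMat q (t ^ 2) j) ?_ ?_ (fun i j h => ?_) hij
  · ext i j
    have h1 := alpha_skein h j
    have h2 := gram_one h j
    simp only [cupMat, sigMat, invMat, cons_val, diagonal_mul, mul_diagonal, of_apply]
    by_cases hi : i = 1
    · subst hi
      rw [h2, mul_assoc, mul_comm (weight _ _ j)]
      congr 2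
      conv_lhs => rw [eq_add_of_sub_eq h1]
      by_cases hj : j = 1
      · subst hj
        simp
        ring
      · simp [Ne.symm hj, hj]
        ring
    · simp [hi]
  · ext i j
    have h2 := gram_one h j
    simp [cupMat, sigMat, invMat, mul_apply, Pi.single_apply, hw, h2, diagonal_apply, mul_comm]
  · simpa [flipMat_cupMat, flipMat_sigMat, flipMat_invMat] using congrArg flipMat h

theorem sigMat_cupMat_cupMat {q t : K} (h : Generic q (t ^ 2)) {i j : Fin 3} (hij : Adjacent i j) :
    sigMat q (t ^ 2) i * cupMat q (t ^ 2) j * cupMat q (t ^ 2) i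
      = invMat q (t ^ 2) j * cupMat q (t ^ 2) i := by
  have hw := weight_ne h 1
  refine adjacent_cases (p := fun i j => sigMat q (t ^ 2) i * cupMat q (t ^ 2) j *
    cupMat q (t ^ 2) i = invMat q (t ^ 2) j * cupMat q (t ^ 2) i) ?_ ?_ (fun i j h => ?_) hij
  · ext i j
    have h1 := alpha_skein h i
    have h2 := gram_one h i
    rw [gram_symm] at h2
    simp only [cupMat, sigMat, invMat, cons_val, diagonal_mul, mul_diagonal, of_apply]
    by_cases hj : j = 1
    · subst hj
      rw [h2]
      congr 2
      conv_lhs => rw [eq_add_of_sub_eq h1]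
      by_cases hj : i = 1
      · subst hj
        simp
        ring
      · simp [hj]
        ring
    · simp [hj]
  · ext i j
    have h2 := gram_one h i
    rw [gram_symm] at h2
    simp [cupMat, sigMat, invMat, mul_apply, Pi.single_apply, hw, h2, diagonal_apply, mul_comm]
  · simpa [flipMat_cupMat, flipMat_sigMat, flipMat_invMat] using congrArg flipMat h

theorem cupMat_sigMat_cupMat {q t : K} (h : Generic q (t ^ 2)) {i j : Fin 3} (hij : Adjacent i j) :
    cupMat q (t ^ 2) i * sigMat q (t ^ 2) j * cupMat q (t ^ 2) i
      = (t ^ 2 * q⁻¹) • cupMat q (t ^ 2) i := by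
  have hw := weight_ne h 1
  refine adjacent_cases (p := fun i j => cupMat q (t ^ 2) i * sigMat q (t ^ 2) j *
    cupMat q (t ^ 2) i = (t ^ 2 * q⁻¹) • cupMat q (t ^ 2) i) ?_ ?_ (fun i j h => ?_) hij
  · ext i j
    simp only [cupMat, sigMat, cons_val, diagonal_mul, mul_diagonal, of_apply, diagonal_apply,
      Matrix.smul_apply]
    by_cases hi : i = 1 <;> by_cases hj : j = 1 <;> by_cases hh : i = j <;>
      simp_all [gram_one h, alpha]
    field_simp
  · ext i j
    have h1 := sum_alpha_weight h
    simp [cupMat, sigMat, mul_apply, diagonal_apply, ← Finset.sum_mul, h1]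
  · simpa [flipMat_cupMat, flipMat_sigMat] using congrArg flipMat h

theorem bmwSystem_mat {q t : K} (h : Generic q (t ^ 2)) :
    BMWSystem q t (sigMat q (t ^ 2)) (invMat q (t ^ 2)) (cupMat q (t ^ 2)) where
  skein := sigMat_sub_invMat h
  mul_inv := sigMat_mul_invMat h
  inv_mul i := mul_eq_one_comm.1 (sigMat_mul_invMat h i)
  far := sigMat_far
  braid _ _ := sigMat_braid h
  ee := cupMat_mul_self h
  se := sigMat_mul_cupMat h
  eee _ _ := cupMat_cupMat_cupMat h
  ees _ _ := cupMat_cupMat_sigMat h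
  see _ _ := sigMat_cupMat_cupMat h
  ese _ _ := cupMat_sigMat_cupMat h

end Matrices

end Representation

/-! ### Relations in the abstract algebra -/

section Relations

variable {K : Type u} [Field K] (q t : K)

theorem mk_U (i : Fin 3) : RingQuot.mkAlgHom K (Rel q t 3) (Free.U q i) = cupcap q t i := by
  simp [Free.U, cupcap, sig, sigInv]

theorem sig_mul_sigInv (i : Fin 3) : sig q t i * sigInv q t i = 1 := by
  simpa [sig, sigInv] using RingQuot.mkAlgHom_rel K (Rel.mul_inv (q := q) (t := t) i)

theorem sigInv_mul_sig (i : Fin 3) : sigInv q t i * sig q t i = 1 := by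
  simpa [sig, sigInv] using RingQuot.mkAlgHom_rel K (Rel.inv_mul (q := q) (t := t) i)

theorem sig_zero_mul_sig_two : sig q t 0 * sig q t 2 = sig q t 2 * sig q t 0 := by
  simpa [sig, sigInv] using RingQuot.mkAlgHom_rel K
    (Rel.far (q := q) (t := t) (0 : Fin 3) 2 (by decide) (by simp [Adjacent]))

variable {i j : Fin 3}

theorem sig_braid (h : Adjacent i j) :
    sig q t i * sig q t j * sig q t i = sig q t j * sig q t i * sig q t j := by
  simpa [sig, sigInv] using RingQuot.mkAlgHom_rel K (Rel.braid (q := q) (t := t) i j h)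

theorem sig_cupcap_cupcap (h : Adjacent i j) :
    sig q t i * cupcap q t j * cupcap q t i = sigInv q t j * cupcap q t i := by
  simpa only [map_mul, mk_U, sig, sigInv] using
    RingQuot.mkAlgHom_rel K (Rel.suu (q := q) (t := t) i j h)

theorem cupcap_sig_sig (h : Adjacent i j) :
    cupcap q t i * sig q t j * sig q t i = cupcap q t i * cupcap q t j := by
  simpa only [map_mul, mk_U, sig, sigInv] using
    RingQuot.mkAlgHom_rel K (Rel.uss (q := q) (t := t) i j h)

theorem sig_sig_cupcap (h : Adjacent i j) :
    sig q t i * sig q t j * cupcap q t i = cupcap q t j * cupcap q t i := by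
  simpa only [map_mul, mk_U, sig, sigInv] using
    RingQuot.mkAlgHom_rel K (Rel.ssu (q := q) (t := t) i j h)

theorem cupcap_mul_self (i : Fin 3) :
    cupcap q t i * cupcap q t i = loopValue q t • cupcap q t i := by
  simpa only [map_mul, map_smul, mk_U, sig, sigInv] using
    RingQuot.mkAlgHom_rel K (Rel.uu (q := q) (t := t) i)

theorem sig_mul_cupcap (i : Fin 3) :
    sig q t i * cupcap q t i = ((t ^ 2)⁻¹ * q) • cupcap q t i := by
  simpa only [map_mul, map_smul, mk_U, sig, sigInv] using
    RingQuot.mkAlgHom_rel K (Rel.su (q := q) (t := t) i)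

variable {q}

theorem sigInv_eq (hz : q - q⁻¹ ≠ 0) (i : Fin 3) :
    sigInv q t i = sig q t i - (q - q⁻¹) • (1 - cupcap q t i) := by
  rw [cupcap, sub_sub_cancel, smul_smul, mul_inv_cancel₀ hz, one_smul, sub_sub_cancel]

variable (q)

/-- The algebra is generated by the `σ_i^{±1}`. -/
theorem bmw_induction {p : BMW4 q t → Prop} (hK : ∀ c : K, p (algebraMap K _ c))
    (hσ : ∀ i, p (sig q t i)) (hτ : ∀ i, p (sigInv q t i)) (hadd : ∀ a b, p a → p b → p (a + b))
    (hmul : ∀ a b, p a → p b → p (a * b)) (a : BMW4 q t) : p a := by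
  obtain ⟨x, rfl⟩ := RingQuot.mkAlgHom_surjective K (Rel q t 3) a
  induction x using FreeAlgebra.induction with
  | grade0 c => simpa using hK c
  | grade1 x =>
    rcases x with i | i
    · exact hσ i
    · exact hτ i
  | mul a b ha hb => simpa using hmul _ _ ha hb
  | add a b ha hb => simpa using hadd _ _ ha hb

end Relations

/-! ### The joint eigenbasis and simplicity -/

section AdjointBasis

variable {K : Type u} [Field K]

/-- A joint eigenbasis of `σ_1` and `σ_3` in the adjoint representation. -/
structure IsAdjointBasis (q t : K) {M : Type v} [AddCommGroup M] [Module K M]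
    [Module (BMW4 q t) M] (ε : Module.Basis (Fin 6) K M) : Prop where
  sig_zero (k) : sig q t 0 • ε k = alpha q (t ^ 2) k • ε k
  sig_two (k) : sig q t 2 • ε k = beta q (t ^ 2) k • ε k
  sig_one (k) : sig q t 1 • ε k = ∑ j, (gram q (t ^ 2) j k * weight q (t ^ 2) k) • ε j
  cupcap_one (k) : cupcap q t 1 • ε k = weight q (t ^ 2) k • ∑ j, ε j

theorem exists_isAdjointBasis {q t : K} (h : Generic q (t ^ 2)) :
    ∃ (M : Type u) (_ : AddCommGroup M) (_ : Module K M) (_ : Module (BMW4 q t) M)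
      (_ : IsScalarTower K (BMW4 q t) M) (ε : Module.Basis (Fin 6) K M),
      IsAdjointBasis q t ε := by
  obtain ⟨f, hf, hf'⟩ := (bmwSystem_mat h).exists_algHom h.sub_inv_ne
  let g : BMW4 q t →ₐ[K] Module.End K (Fin 6 → K) := Matrix.toLinAlgEquiv'.toAlgHom.comp f
  let _ : Module (BMW4 q t) (Fin 6 → K) := Module.compHom _ g.toRingHom
  have hg (a : BMW4 q t) (k : Fin 6) : a • Pi.basisFun K (Fin 6) k = (f a).col k := by
    change Matrix.toLinAlgEquiv' (f a) _ = _
    simp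
  refine ⟨Fin 6 → K, inferInstance, inferInstance, inferInstance, ⟨fun c a m => ?_⟩,
    Pi.basisFun K (Fin 6), ⟨fun k => ?_, fun k => ?_, fun k => ?_, fun k => ?_⟩⟩
  · change g (c • a) m = c • g a m
    simp
  all_goals
    rw [hg]
    try rw [hf]
    try rw [hf']
    ext i
    simp [sigMat, cupMat, Matrix.diagonal_apply, Pi.single_apply, Finset.sum_apply]
  all_goals
    split_ifs with hik
    · rw [hik]
    · rfl

variable {q t : K} {M : Type v} [AddCommGroup M] [Module K M] [Module (BMW4 q t) M]
  [IsScalarTower K (BMW4 q t) M]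

/-- An invariant subspace contains the eigenvectors which occur in its elements, if the
eigenvalues are distinct. -/
theorem basis_mem_of_repr_ne_zero {ι : Type*} [Fintype ι] [DecidableEq ι]
    (ε : Module.Basis ι K M) (a : BMW4 q t) (μ : ι → K) (hμ : Function.Injective μ)
    (ha : ∀ i, a • ε i = μ i • ε i) (W : Submodule (BMW4 q t) M) {w : M} (hw : w ∈ W) (k : ι)
    (hk : ε.repr w k ≠ 0) : ε k ∈ W := by
  have haeval (p : Polynomial K) (i : ι) : Polynomial.aeval a p • ε i = p.eval (μ i) • ε i := by
    induction p using Polynomial.induction_on' with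
    | add p r hp hr => simp [add_smul, hp, hr]
    | monomial n c =>
      have hpow : a ^ n • ε i = μ i ^ n • ε i := by
        induction n with
        | zero => simp
        | succ n ih => rw [pow_succ, mul_smul, ha, smul_comm, ih, smul_smul, pow_succ, mul_comm]
      rw [Polynomial.aeval_monomial, mul_smul, hpow, algebraMap_smul, smul_smul,
        Polynomial.eval_monomial]
  -- Evaluated at `a`, this interpolation polynomial is the projection onto the line of `ε k`, and
  -- it preserves every submodule.
  let p := Lagrange.basis Finset.univ μ k
  have hp (i : ι) : Polynomial.aeval a p • ε i = if i = k then ε k else 0 := by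
    rw [haeval]
    by_cases hi : i = k
    · subst hi
      simp [p, Lagrange.eval_basis_self hμ.injOn]
    · simp [p, hi, Lagrange.eval_basis_of_ne (Ne.symm hi)]
  have hsum : Polynomial.aeval a p • w = ε.repr w k • ε k := by
    conv_lhs => rw [← ε.sum_repr w]
    rw [Finset.smul_sum]
    simp only [smul_comm (Polynomial.aeval a p), hp, smul_ite, smul_zero]
    simp
  have hmem : ε.repr w k • ε k ∈ W := hsum ▸ W.smul_mem _ hw
  have hmem' := W.smul_mem (algebraMap K (BMW4 q t) (ε.repr w k)⁻¹) hmem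
  rwa [algebraMap_smul, smul_smul, inv_mul_cancel₀ hk, one_smul] at hmem'

/-- The eigenvalues of `σ_1 + 2 σ_3`, which separate the joint eigenbasis. -/
def eigenSum (q Q : K) (k : Fin 6) : K := alpha q Q k + 2 * beta q Q k

/-- A nonzero submodule contains some ε_k by separation of eigenvalues. Then u_2 ε_k is a nonzero
multiple of ∑ ε_j, which has every coordinate nonzero, so separation yields the whole basis. -/
theorem IsAdjointBasis.isSimpleModule {ε : Module.Basis (Fin 6) K M} (H : IsAdjointBasis q t ε)
    (h : Generic q (t ^ 2)) (hinj : Function.Injective (eigenSum q (t ^ 2))) :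
    IsSimpleModule (BMW4 q t) M := by
  have hne : ε 0 ≠ 0 := ε.ne_zero 0
  have : Nontrivial M := ⟨ε 0, 0, hne⟩
  refine isSimpleModule_iff _ _ |>.2 ⟨fun W => ?_⟩
  rw [or_iff_not_imp_left]
  intro hW
  obtain ⟨w, hw, hw0⟩ := W.ne_bot_iff.1 hW
  have hmem {w : M} (hw : w ∈ W) := basis_mem_of_repr_ne_zero ε (sig q t 0 + (2 : K) • sig q t 2) _ hinj
    (fun i => by
      rw [add_smul, smul_assoc, H.sig_zero, H.sig_two, smul_smul, ← add_smul, eigenSum]) W hw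
  obtain ⟨k, hk⟩ : ∃ k, ε.repr w k ≠ 0 := by
    by_contra! hcon
    exact hw0 (ε.repr.map_eq_zero_iff.1 (Finsupp.ext hcon))
  have h1 := W.smul_mem (cupcap q t 1) (hmem hw k hk)
  rw [H.cupcap_one, Finset.smul_sum] at h1
  have h2 (j) : ε j ∈ W := hmem h1 j (by
    simp [Finsupp.single_apply, weight_ne h])
  rw [eq_top_iff]
  intro m _
  rw [← ε.sum_repr m]
  refine W.sum_mem fun j _ => ?_
  rw [← algebraMap_smul (BMW4 q t)]
  exact W.smul_mem _ (h2 j)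

end AdjointBasis

/-! ### A truncation vector generates at most six dimensions -/

section Span

variable {K : Type u} [Field K] {q t : K} {N : Type v} [AddCommGroup N] [Module K N]
  [Module (BMW4 q t) N] [IsScalarTower K (BMW4 q t) N]

theorem sig_mul_self (hz : q - q⁻¹ ≠ 0) (i : Fin 3) :
    sig q t i * sig q t i
      = 1 + (q - q⁻¹) • (sig q t i - ((t ^ 2)⁻¹ * q) • cupcap q t i) := by
  have h := sig_mul_sigInv q t i
  rw [sigInv_eq t hz, mul_sub, mul_smul_comm, mul_sub, mul_one, sig_mul_cupcap] at h
  rw [← h]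
  abel

theorem sig_smul_sig_smul (hz : q - q⁻¹ ≠ 0) (i : Fin 3) (w : N) :
    sig q t i • sig q t i • w
      = w + (q - q⁻¹) • (sig q t i • w - ((t ^ 2)⁻¹ * q) • cupcap q t i • w) := by
  rw [smul_smul, sig_mul_self hz, add_smul, one_smul, smul_assoc, sub_smul (sig q t i), smul_assoc]

theorem sigInv_smul (hz : q - q⁻¹ ≠ 0) (i : Fin 3) (w : N) :
    sigInv q t i • w = sig q t i • w - (q - q⁻¹) • (w - cupcap q t i • w) := by
  rw [sigInv_eq t hz, sub_smul (sig q t i), smul_assoc, sub_smul 1, one_smul]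

theorem cupcap_zero_mul_sig_two : cupcap q t 0 * sig q t 2 = sig q t 2 * cupcap q t 0 := by
  have h1 := sig_zero_mul_sig_two q t
  have h2 : sigInv q t 0 * sig q t 2 = sig q t 2 * sigInv q t 0 := by
    calc sigInv q t 0 * sig q t 2
        = sigInv q t 0 * (sig q t 2 * sig q t 0) * sigInv q t 0 := by
          rw [mul_assoc, mul_assoc, sig_mul_sigInv, mul_one]
      _ = _ := by rw [← h1, ← mul_assoc, sigInv_mul_sig, one_mul]
  simp only [cupcap, sub_mul, mul_sub, smul_mul_assoc, mul_smul_comm, one_mul, mul_one, h1, h2]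

/-- A finite-dimensional subspace stable under `σ_i` is stable under `σ_i⁻¹`. -/
theorem sigInv_smul_mem {W : Submodule K N} [FiniteDimensional K W] (i : Fin 3)
    (hW : ∀ w ∈ W, sig q t i • w ∈ W) {w : N} (hw : w ∈ W) : sigInv q t i • w ∈ W := by
  let f : W →ₗ[K] W := (Algebra.lsmul K K N (sig q t i)).restrict hW
  have hf : Function.Injective f := by
    intro x y hxy
    have h : sig q t i • (x : N) = sig q t i • (y : N) := congrArg Subtype.val hxy
    have h' := congrArg (sigInv q t i • ·) h
    simp only [smul_smul, sigInv_mul_sig, one_smul] at h'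
    exact Subtype.ext h'
  obtain ⟨x, hx⟩ := LinearMap.injective_iff_surjective.1 hf ⟨w, hw⟩
  have h : sig q t i • (x : N) = w := congrArg Subtype.val hx
  rw [← h, smul_smul, sigInv_mul_sig, one_smul]
  exact x.2

/-- A finite-dimensional subspace stable under the braid generators is a submodule. -/
def stableSubmodule (W : Submodule K N) [FiniteDimensional K W]
    (hW : ∀ i, ∀ w ∈ W, sig q t i • w ∈ W) : Submodule (BMW4 q t) N where
  toAddSubmonoid := W.toAddSubmonoid
  smul_mem' a := by
    refine bmw_induction q t (p := fun a => ∀ {w : N}, w ∈ W → a • w ∈ W) ?_ ?_ ?_ ?_ ?_ a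
    · intro c w hw
      rw [algebraMap_smul]
      exact W.smul_mem c hw
    · exact fun i w hw => hW i w hw
    · exact fun i w hw => sigInv_smul_mem i (hW i) hw
    · intro a b ha hb w hw
      rw [add_smul]
      exact W.add_mem (ha hw) (hb hw)
    · intro a b ha hb w hw
      rw [mul_smul]
      exact ha (hb hw)

variable (q t) in
/-- The translates of a vector in the truncation which span the submodule it generates. -/
def spanningFamily (x : N) : Fin 6 → N :=
  ![x, cupcap q t 1 • x, cupcap q t 0 • cupcap q t 1 • x, sig q t 1 • x,
    sig q t 0 • sig q t 1 • x, sig q t 0 • cupcap q t 1 • x]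

/-- Since x is a multiple of both σ_1 x and u_3 x, either generator may be inserted next to x, and
the relations then shorten the word. Repeated generators are removed by the quadratic relation. -/
theorem sig_smul_spanningFamily_mem (hq : q ≠ 0) (hz : q - q⁻¹ ≠ 0) (hδ : loopValue q t ≠ 0)
    {x : N} (hx : sig q t 0 • x = (-q⁻¹) • x) (hx' : cupcap q t 2 • x = loopValue q t • x)
    (i : Fin 3) (k : Fin 6) :
    sig q t i • spanningFamily q t x k ∈ Submodule.span K (Set.range (spanningFamily q t x)) := by
  set W := Submodule.span K (Set.range (spanningFamily q t x))
  have mem (k) : spanningFamily q t x k ∈ W := Submodule.subset_span ⟨k, rfl⟩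
  have m0 : x ∈ W := mem 0
  have m1 : cupcap q t 1 • x ∈ W := mem 1
  have m2 : cupcap q t 0 • cupcap q t 1 • x ∈ W := mem 2
  have m3 : sig q t 1 • x ∈ W := mem 3
  have m4 : sig q t 0 • sig q t 1 • x ∈ W := mem 4
  have m5 : sig q t 0 • cupcap q t 1 • x ∈ W := mem 5
  have hxu : x = (loopValue q t)⁻¹ • cupcap q t 2 • x := by
    rw [hx', smul_smul, inv_mul_cancel₀ hδ, one_smul]
  have hxs : x = (-q) • sig q t 0 • x := by
    rw [hx, smul_smul, neg_mul_neg, mul_inv_cancel₀ hq, one_smul]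
  have a01 : Adjacent (0 : Fin 3) 1 := by simp [Adjacent]
  have a21 : Adjacent (2 : Fin 3) 1 := by simp [Adjacent]
  have sq (i : Fin 3) (w : N) (hw : w ∈ W) (h1 : sig q t i • w ∈ W) (h2 : cupcap q t i • w ∈ W) :
      sig q t i • sig q t i • w ∈ W := by
    rw [sig_smul_sig_smul hz]
    exact W.add_mem hw (W.smul_mem _ (W.sub_mem h1 (W.smul_mem _ h2)))
  have inv (i : Fin 3) (w : N) (hw : w ∈ W) (h1 : sig q t i • w ∈ W) (h2 : cupcap q t i • w ∈ W) :
      sigInv q t i • w ∈ W := by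
    rw [sigInv_smul hz]
    exact W.sub_mem h1 (W.smul_mem _ (W.sub_mem hw h2))
  -- Inserting σ_1 before x gives u_1 σ_2 σ_1 = u_1 u_2.
  have u03 : cupcap q t 0 • sig q t 1 • x ∈ W := by
    rw [hxs, smul_comm (sig q t 1), smul_comm (cupcap q t 0), smul_smul, smul_smul,
      cupcap_sig_sig q t a01, mul_smul]
    exact W.smul_mem _ m2
  have u00 : cupcap q t 0 • x ∈ W := by
    have h := congrArg (sigInv q t 0 • ·) hx
    simp only [smul_smul, sigInv_mul_sig, one_smul] at h
    rw [smul_comm] at h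
    have h' : sigInv q t 0 • x = (-q) • x := by
      conv_rhs => rw [h]
      rw [smul_smul, neg_mul_neg, mul_inv_cancel₀ hq, one_smul]
    rw [cupcap, sub_smul, one_smul, smul_assoc, sub_smul, hx, h']
    exact W.sub_mem m0 (W.smul_mem _ (W.sub_mem (W.smul_mem _ m0) (W.smul_mem _ m0)))
  -- Inserting u_3 before x gives σ_3 u_2 u_3 = σ_2⁻¹ u_3.
  have s21 : sig q t 2 • cupcap q t 1 • x = sigInv q t 1 • x := by
    rw [hxu, smul_comm (cupcap q t 1), smul_comm (sig q t 2), smul_comm (sigInv q t 1), smul_smul,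
      smul_smul, sig_cupcap_cupcap q t a21, mul_smul]
  have s21' : sig q t 2 • cupcap q t 1 • x
      = sig q t 1 • x - (q - q⁻¹) • (x - cupcap q t 1 • x) := by
    rw [s21, sigInv_smul hz]
  have s23 : sig q t 2 • sig q t 1 • x = cupcap q t 1 • x := by
    rw [hxu, smul_comm (cupcap q t 1), smul_comm (sig q t 1), smul_comm (sig q t 2), smul_smul,
      smul_smul, sig_sig_cupcap q t a21, mul_smul]
  have comm (w : N) : sig q t 2 • sig q t 0 • w = sig q t 0 • sig q t 2 • w := by
    rw [smul_smul, smul_smul, sig_zero_mul_sig_two]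
  have s00 : sig q t 0 • x ∈ W := hx ▸ W.smul_mem _ m0
  fin_cases i <;> fin_cases k <;> simp only [spanningFamily] <;> simp
  · exact s00
  · exact m5
  · rw [smul_smul, sig_mul_cupcap, smul_assoc]
    exact W.smul_mem _ m2
  · exact m4
  · exact sq 0 _ m3 m4 u03
  · exact sq 0 _ m1 m5 m2
  · exact m3
  · rw [smul_smul, sig_mul_cupcap, smul_assoc]
    exact W.smul_mem _ m1
  · rw [smul_smul, smul_smul, sig_cupcap_cupcap q t a01.symm, mul_smul]
    exact inv 0 _ m1 m5 m2
  · exact sq 1 _ m0 m3 m1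
  -- The braid relation moves a σ_1 next to x, where it acts by a scalar.
  · rw [smul_smul, smul_smul, ← sig_braid q t a01, mul_smul, hx, smul_comm, mul_smul]
    exact W.smul_mem _ m4
  · rw [smul_smul, smul_smul, sig_sig_cupcap q t a01.symm, mul_smul]
    exact m2
  · rw [hxu, smul_comm, smul_smul, sig_mul_cupcap, smul_assoc, ← smul_comm, ← hxu]
    exact W.smul_mem _ m0
  · rw [s21]
    exact inv 1 _ m0 m3 m1
  · rw [smul_smul, ← cupcap_zero_mul_sig_two, mul_smul, s21', smul_sub,
      smul_comm (cupcap q t 0) (q - q⁻¹), smul_sub]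
    exact W.sub_mem u03 (W.smul_mem _ (W.sub_mem u00 m2))
  · rw [s23]
    exact m1
  · rw [comm, s23]
    exact m5
  · rw [comm, s21', smul_sub, smul_comm (sig q t 0) (q - q⁻¹), smul_sub]
    exact W.sub_mem m4 (W.smul_mem _ (W.sub_mem s00 m5))

/-- A vector in the truncation generates a submodule of dimension at most six. -/
theorem exists_submodule_finrank_le (hq : q ≠ 0) (hz : q - q⁻¹ ≠ 0) (hδ : loopValue q t ≠ 0)
    {x : N} (hx : sig q t 0 • x = (-q⁻¹) • x) (hx' : cupcap q t 2 • x = loopValue q t • x) :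
    ∃ W : Submodule (BMW4 q t) N, x ∈ W ∧ FiniteDimensional K W ∧ Module.finrank K W ≤ 6 := by
  let V := Submodule.span K (Set.range (spanningFamily q t x))
  have hfin : FiniteDimensional K V := FiniteDimensional.span_of_finite K (Set.finite_range _)
  have hV (i) (w) (hw : w ∈ V) : sig q t i • w ∈ V := by
    have hle : V ≤ V.comap (Algebra.lsmul K K N (sig q t i)) := by
      refine Submodule.span_le.2 ?_
      rintro _ ⟨k, rfl⟩
      exact sig_smul_spanningFamily_mem hq hz hδ hx hx' i k
    exact hle hw
  have hrank : Module.finrank K V ≤ 6 := by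
    have h : Module.finrank K V ≤ Fintype.card (Fin 6) := finrank_range_le_card _
    simpa using h
  exact ⟨stableSubmodule V hV, Submodule.subset_span ⟨0, rfl⟩, hfin, hrank⟩

end Span

/-! ### Every adjoint component is isomorphic to the model -/

section Uniqueness

variable {K : Type u} [Field K] {q t : K}

theorem IsAdjointBasis.map {M : Type v} {N : Type w} [AddCommGroup M] [Module K M]
    [Module (BMW4 q t) M] [IsScalarTower K (BMW4 q t) M] [AddCommGroup N] [Module K N]
    [Module (BMW4 q t) N] [IsScalarTower K (BMW4 q t) N] {ε : Module.Basis (Fin 6) K N}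
    (H : IsAdjointBasis q t ε) (e : N ≃ₗ[BMW4 q t] M) :
    IsAdjointBasis q t (ε.map (e.restrictScalars K)) := by
  have hK (c : K) (n : N) : e (c • n) = c • e n := (e.restrictScalars K).map_smul c n
  refine ⟨fun k => ?_, fun k => ?_, fun k => ?_, fun k => ?_⟩
  · simp [← map_smul, H.sig_zero, hK]
  · simp [← map_smul, H.sig_two, hK]
  · simp [← map_smul, H.sig_one, hK]
  · simp [← map_smul, H.cupcap_one, hK]

theorem sigInv_cupcap_smul {M : Type v} [AddCommGroup M] [Module K M] [Module (BMW4 q t) M]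
    [IsScalarTower K (BMW4 q t) M] {i : Fin 3} {c : K} (hc : c ≠ 0) {m : M}
    (hm : sig q t i • m = c • m) :
    sigInv q t i • m = c⁻¹ • m ∧ cupcap q t i • m = (1 - (q - q⁻¹)⁻¹ * (c - c⁻¹)) • m := by
  have h := congrArg (sigInv q t i • ·) hm
  simp only [smul_smul, sigInv_mul_sig, one_smul] at h
  rw [smul_comm] at h
  have h' : sigInv q t i • m = c⁻¹ • m := by
    conv_rhs => rw [h]
    rw [smul_smul, inv_mul_cancel₀ hc, one_smul]
  refine ⟨h', ?_⟩
  rw [cupcap, sub_smul 1, one_smul, smul_assoc, sub_smul (sig q t i), hm, h', ← sub_smul,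
    smul_smul, sub_smul 1, one_smul]

/-- Over generic parameters, a module is the adjoint representation as soon as it is simple and has
a nonzero vector of the right type in its truncation. -/
theorem exists_isAdjointBasis_of_simple (h : Generic q (t ^ 2))
    (hinj : Function.Injective (eigenSum q (t ^ 2))) {M : Type v} [AddCommGroup M] [Module K M]
    [Module (BMW4 q t) M] [IsScalarTower K (BMW4 q t) M] [IsSimpleModule (BMW4 q t) M] {x : M}
    (hx0 : x ≠ 0) (hx : sig q t 0 • x = (-q⁻¹) • x)
    (hx' : cupcap q t 2 • x = loopValue q t • x) :
    ∃ ε : Module.Basis (Fin 6) K M, IsAdjointBasis q t ε := by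
  obtain ⟨N, _, _, _, _, ε, hε⟩ := exists_isAdjointBasis h
  have hN : IsSimpleModule (BMW4 q t) N := hε.isSimpleModule h hinj
  have hδ : loopValue q t ≠ 0 := by
    rw [loopValue_eq_inv h]
    exact inv_ne_zero (weight_ne h 1)
  have h0 : sig q t 0 • ε 0 = (-q⁻¹) • ε 0 := by simp [hε.sig_zero, alpha]
  have h0' : cupcap q t 2 • ε 0 = loopValue q t • ε 0 := by
    rw [(sigInv_cupcap_smul (beta_ne h 0) (hε.sig_two 0)).2]
    have h1 := alpha_skein h 1
    rw [← loopValue_eq_inv h, Pi.single_eq_same] at h1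
    rw [← alpha_flip, show flip 0 = 1 from rfl, h1, ← mul_assoc, inv_mul_cancel₀ h.sub_inv_ne,
      one_mul, sub_sub_cancel]
  -- Goursat argument: W surjects onto the simple module N, whose dimension is six, so the dimension
  -- bound makes this projection an isomorphism. Thus W is the graph of a map N → M sending ε_0 to
  -- x.
  obtain ⟨W, hW, _, hrank⟩ := exists_submodule_finrank_le (N := N × M) (x := (ε 0, x)) h.q_ne
    h.sub_inv_ne hδ (by ext <;> simp [h0, hx]) (by ext <;> simp [h0', hx'])
  let f : W →ₗ[BMW4 q t] N := (LinearMap.fst _ N M).comp W.subtype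
  have hf0 : f ≠ 0 := by
    intro hf
    exact ε.ne_zero 0 (LinearMap.congr_fun hf ⟨_, hW⟩)
  have hfs := LinearMap.surjective_of_ne_zero (R := BMW4 q t) (M := W) (N := N) (f := f) hf0
  have hfi : Function.Injective f := by
    have hN6 : Module.finrank K N = 6 := by simp [Module.finrank_eq_card_basis ε]
    have hfin : FiniteDimensional K N := ε.finiteDimensional_of_finite
    let fK : W →ₗ[K] N := f.restrictScalars K
    have hfK : Function.Surjective fK := hfs
    have hle := LinearMap.finrank_le_finrank_of_surjective hfK
    have hWN : Module.finrank K W = Module.finrank K N := by omega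
    exact (LinearMap.injective_iff_surjective_of_finrank_eq_finrank (K := K) (V := W) (V₂ := N) (f := fK) hWN).2 hfK
  let e := LinearEquiv.ofBijective f ⟨hfi, hfs⟩
  let g : N →ₗ[BMW4 q t] M := ((LinearMap.snd _ N M).comp W.subtype).comp e.symm.toLinearMap
  have hg : g (ε 0) = x := by
    have : e.symm (ε 0) = ⟨_, hW⟩ := e.symm_apply_eq.2 rfl
    simp [g, this]
  have hg0 : g ≠ 0 := by
    intro h
    rw [h] at hg
    exact hx0 hg.symm
  exact ⟨_, hε.map (LinearEquiv.ofBijective g (LinearMap.bijective_of_ne_zero hg0))⟩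

theorem IsAdjointComponent.exists_isAdjointBasis (h : Generic q (t ^ 2))
    (hinj : Function.Injective (eigenSum q (t ^ 2))) {M : Type v} [AddCommGroup M] [Module K M]
    [Module (BMW4 q t) M] [IsScalarTower K (BMW4 q t) M] (H : IsAdjointComponent q t M) :
    ∃ ε : Module.Basis (Fin 6) K M, IsAdjointBasis q t ε := by
  have := H.simple
  obtain ⟨m, hm⟩ := H.truncation_ne_zero
  refine exists_isAdjointBasis_of_simple h hinj hm ?_ ?_
  · have := H.truncation_eq m
    rwa [mul_smul, mul_smul, algebraMap_smul] at this
  · rw [smul_smul, cupcap_mul_self, smul_assoc]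

end Uniqueness

/-! ### Explicit entries of the fused R-matrix -/

section Entries

variable {K : Type u} [Field K]

/-- The eigenvalue of `R_i(w)` on an eigenvector of `σ_i` with eigenvalue `a` and its inverse. -/
def rEig (q Q w a : K) : K :=
  (w - 1) * q⁻¹ * a - (1 - w⁻¹) * Q⁻¹ * q * a⁻¹ - (q - q⁻¹) * (Q⁻¹ * q - q⁻¹)

/-- The symmetric matrix with `R_2(w) ε_j = ∑ k, (rGram k j * weight j) • ε_k`. -/
def rGram (q Q w : K) (i j : Fin 6) : K :=
  ((1 - q ^ 2 / (Q * w)) * ((w - 1) * gram q Q i j + if i = j then (q - q⁻¹) / weight q Q i else 0)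
    - (w - 1) * q ^ 2 * (q - q⁻¹) / (Q * w)) / q

/-- The left side is R_2(w) in coordinates after eliminating σ_2⁻¹ by the skein relation. -/
theorem rGram_eq {q Q w : K} (h : Generic q Q) (hw : w ≠ 0) (i j : Fin 6) :
    (w - 1) * q⁻¹ * (gram q Q i j * weight q Q j)
      - (1 - w⁻¹) * Q⁻¹ * q * (gram q Q i j * weight q Q j
        - (q - q⁻¹) * ((if i = j then 1 else 0) - weight q Q j))
      - (q - q⁻¹) * (Q⁻¹ * q - q⁻¹) * (if i = j then 1 else 0)
      = rGram q Q w i j * weight q Q j := by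
  have hq := h.q_ne
  have hQ := h.Q_ne
  have hwt := weight_ne h j
  by_cases hij : i = j
  · subst hij
    simp only [rGram, if_true]
    field_simp
    ring
  · simp only [rGram, if_neg hij]
    field_simp
    ring

/-- The coefficients of `R_2(q⁻² y²) R_1(y²) R_3(y²) R_2(q² y²)`, up to the weights. -/
def fusedGram (q t y : K) (i j : Fin 6) : K :=
  ∑ k, rGram q (t ^ 2) (q⁻¹ ^ 2 * y ^ 2) i k * weight q (t ^ 2) k
    * rEig q (t ^ 2) (y ^ 2) (alpha q (t ^ 2) k) * rEig q (t ^ 2) (y ^ 2) (beta q (t ^ 2) k)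
    * rGram q (t ^ 2) (q ^ 2 * y ^ 2) k j

theorem rGram_flip (q Q w : K) (i j : Fin 6) : rGram q Q w (flip i) (flip j) = rGram q Q w i j := by
  simp only [rGram, gram_flip, weight_flip, flip.injective.eq_iff]

theorem fusedGram_flip (q t y : K) (i j : Fin 6) :
    fusedGram q t y (flip i) (flip j) = fusedGram q t y i j := by
  rw [fusedGram, ← Equiv.sum_comp flip]
  simp only [rGram_flip, weight_flip, alpha_flip, beta_flip]
  exact Finset.sum_congr rfl fun k _ => by ring

variable {q t y : K}

-- This and the next four identities are the entries needed up to `flip`. The sum runs over all six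
-- k because E_1 E_3 acts only after the four R factors. Multiplying by `normFactor` keeps them
-- valid where it vanishes.
set_option maxHeartbeats 4000000 in
theorem fusedGram_zero_zero (h : Generic q (t ^ 2)) (ht : t ≠ 0) (hy : y ≠ 0) :
    fusedGram q t y 0 0 * weight q (t ^ 2) 0 = normFactor q t y *
      (br q t y 0 0 2 * br q t y 1 0 (-2) * (cu q t y 1 1 (-1) / cu q t y 1 0 (-1))) := by
  have hz := h.sub_inv_ne
  obtain ⟨hq, hQ, h1, h2, h3, h4, h5, h6, h7, h8⟩ := h
  simp [fusedGram, Fin.sum_univ_six, gram, weight, alpha, beta, rEig, rGram, normFactor, br, cu,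
    zpow_ofNat, zpow_neg]
  field_simp
  ring

set_option maxHeartbeats 4000000 in
theorem fusedGram_zero_one (h : Generic q (t ^ 2)) (ht : t ≠ 0) (hy : y ≠ 0) :
    fusedGram q t y 0 1 * weight q (t ^ 2) 1 = normFactor q t y *
      (br q t y 0 1 2 * br q t y 0 1 (-1) * br q t y 1 1 (-2) +
        br q t y 0 0 2 * br q t y 1 0 (-2) * (cu q t y 1 1 (-1) / cu q t y 1 0 (-1))) := by
  have hz := h.sub_inv_ne
  obtain ⟨hq, hQ, h1, h2, h3, h4, h5, h6, h7, h8⟩ := h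
  simp [fusedGram, Fin.sum_univ_six, gram, weight, alpha, beta, rEig, rGram, normFactor, br, cu,
    zpow_ofNat, zpow_neg]
  field_simp
  ring

-- The sign and the missing weight come from e_3 = -(weight 2)⁻¹ ε_2; the same scaling produces the
-- factor -(weight 2) in the transposed entry.
set_option maxHeartbeats 4000000 in
theorem fusedGram_zero_two (h : Generic q (t ^ 2)) (ht : t ≠ 0) (hy : y ≠ 0) :
    -fusedGram q t y 0 2 = normFactor q t y * c21 q t y := by
  have hz := h.sub_inv_ne
  obtain ⟨hq, hQ, h1, h2, h3, h4, h5, h6, h7, h8⟩ := h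
  simp [fusedGram, Fin.sum_univ_six, gram, weight, alpha, beta, rEig, rGram, normFactor, br, c21,
    zpow_ofNat, zpow_neg]
  field_simp
  ring

set_option maxHeartbeats 4000000 in
theorem fusedGram_two_zero (h : Generic q (t ^ 2)) (ht : t ≠ 0) (hy : y ≠ 0) :
    -weight q (t ^ 2) 2 * (fusedGram q t y 2 0 * weight q (t ^ 2) 0) = normFactor q t y *
      (br q t y 0 1 0 * br q t y 1 0 (-1) * cu q t y 1 0 0 * cu q t y 1 0 (-3)
        / cu q t y 1 0 (-1) ^ 2) := by
  have hz := h.sub_inv_ne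
  obtain ⟨hq, hQ, h1, h2, h3, h4, h5, h6, h7, h8⟩ := h
  simp [fusedGram, Fin.sum_univ_six, gram, weight, alpha, beta, rEig, rGram, normFactor, br, cu,
    zpow_ofNat, zpow_neg]
  field_simp
  ring

set_option maxHeartbeats 4000000 in
theorem fusedGram_two_two (h : Generic q (t ^ 2)) (ht : t ≠ 0) (hy : y ≠ 0) :
    fusedGram q t y 2 2 * weight q (t ^ 2) 2 = normFactor q t y * c22 q t y := by
  have hz := h.sub_inv_ne
  obtain ⟨hq, hQ, h1, h2, h3, h4, h5, h6, h7, h8⟩ := h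
  simp [fusedGram, Fin.sum_univ_six, gram, weight, alpha, beta, rEig, rGram, normFactor, br, cu,
    c22, zpow_ofNat, zpow_neg]
  field_simp
  ring

end Entries

/-! ### Action of E_i, R_i and S on the eigenbasis -/

section Action

variable {K : Type u} [Field K] {q t : K} {M : Type v} [AddCommGroup M] [Module K M]
  [Module (BMW4 q t) M] [IsScalarTower K (BMW4 q t) M] {ε : Module.Basis (Fin 6) K M}

theorem beta_skein (h : Generic q (t ^ 2)) (i : Fin 6) :
    beta q (t ^ 2) i - (beta q (t ^ 2) i)⁻¹
      = (q - q⁻¹) * (1 - (Pi.single 0 (weight q (t ^ 2) 1)⁻¹ : Fin 6 → K) i) := by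
  rw [← alpha_flip, alpha_skein h]
  congr 2
  revert i
  generalize (weight q (t ^ 2) 1)⁻¹ = c
  intro i
  obtain ⟨h0, h1, h2, h3, h4, h5⟩ := flip_vals
  fin_cases i <;> simp [h0, h1, h2, h3, h4, h5]

/-- The denominator [n-1] + 1 is δ itself, so the u_i term of E_i exactly corrects q - σ_i on the
trivial summand. -/
theorem E_scalar (h : Generic q (t ^ 2)) {a u : K}
    (hau : a = -q⁻¹ ∧ u = 0 ∨ a = (t ^ 2)⁻¹ * q ∧ u = loopValue q t) :
    (q + q⁻¹)⁻¹ * (q - a + (q * (t ^ 2)⁻¹ + q⁻¹) / (br q t 1 2 0 (-1) + 1) * u) = 1 := by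
  have hδ : loopValue q t ≠ 0 := by
    rw [loopValue_eq_inv h]
    exact inv_ne_zero (weight_ne h 1)
  have hbr : br q t 1 2 0 (-1) + 1 = loopValue q t := by
    simp [br, loopValue, zpow_ofNat, zpow_neg, add_comm]
  have hq := h.add_inv_ne
  rw [hbr]
  rcases hau with ⟨rfl, rfl⟩ | ⟨rfl, rfl⟩
  · rw [mul_zero, add_zero, sub_neg_eq_add, inv_mul_cancel₀ hq]
  · rw [div_mul_cancel₀ _ hδ, ← inv_mul_cancel₀ hq]
    ring

theorem E_smul {i : Fin 3} {a u : K} {m : M} (hs : sig q t i • m = a • m)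
    (hu : cupcap q t i • m = u • m) :
    E q t i • m = ((q + q⁻¹)⁻¹ *
      (q - a + (q * (t ^ 2)⁻¹ + q⁻¹) / (br q t 1 2 0 (-1) + 1) * u)) • m := by
  rw [E, smul_assoc, add_smul (_ - _), sub_smul (algebraMap _ _ _), algebraMap_smul, hs,
    smul_assoc, hu, smul_smul, ← sub_smul, ← add_smul, smul_smul]

theorem R_smul {i : Fin 3} {a w : K} {m : M} (hs : sig q t i • m = a • m)
    (hτ : sigInv q t i • m = a⁻¹ • m) : R q t i w • m = rEig q (t ^ 2) w a • m := by
  rw [R, sub_smul (_ - _), sub_smul (_ • _), smul_assoc, smul_assoc, algebraMap_smul, hs, hτ,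
    smul_smul, smul_smul, ← sub_smul, ← sub_smul, rEig]

namespace IsAdjointBasis

variable (H : IsAdjointBasis q t ε) (h : Generic q (t ^ 2))
include H h

theorem cupcap_zero (k : Fin 6) :
    cupcap q t 0 • ε k = (Pi.single 1 (loopValue q t) : Fin 6 → K) k • ε k := by
  rw [(sigInv_cupcap_smul (alpha_ne h k) (H.sig_zero k)).2, alpha_skein h, ← mul_assoc,
    inv_mul_cancel₀ h.sub_inv_ne, one_mul, sub_sub_cancel, loopValue_eq_inv h]

theorem cupcap_two (k : Fin 6) :
    cupcap q t 2 • ε k = (Pi.single 0 (loopValue q t) : Fin 6 → K) k • ε k := by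
  rw [(sigInv_cupcap_smul (beta_ne h k) (H.sig_two k)).2, beta_skein h, ← mul_assoc,
    inv_mul_cancel₀ h.sub_inv_ne, one_mul, sub_sub_cancel, loopValue_eq_inv h]

theorem R_zero (w : K) (k : Fin 6) :
    R q t 0 w • ε k = rEig q (t ^ 2) w (alpha q (t ^ 2) k) • ε k :=
  R_smul (H.sig_zero k) (sigInv_cupcap_smul (alpha_ne h k) (H.sig_zero k)).1

theorem R_two (w : K) (k : Fin 6) :
    R q t 2 w • ε k = rEig q (t ^ 2) w (beta q (t ^ 2) k) • ε k :=
  R_smul (H.sig_two k) (sigInv_cupcap_smul (beta_ne h k) (H.sig_two k)).1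

theorem R_one {w : K} (hw : w ≠ 0) (k : Fin 6) :
    R q t 1 w • ε k = ∑ j, (rGram q (t ^ 2) w j k * weight q (t ^ 2) k) • ε j := by
  have hk : ε k = ∑ j, (if j = k then (1 : K) else 0) • ε j := by simp
  rw [R, sub_smul (_ - _), sub_smul (_ • _), smul_assoc, smul_assoc, algebraMap_smul,
    sigInv_smul h.sub_inv_ne, H.sig_one, H.cupcap_one]
  conv_lhs => rw [hk]
  simp only [Finset.smul_sum, ← Finset.sum_sub_distrib, smul_smul, ← sub_smul]
  refine Finset.sum_congr rfl fun j _ => ?_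
  rw [← rGram_eq h hw]

/-- E_i kills the eigenvalue q and fixes the other two; indices 3, 4, 5 are those where σ_1 or σ_3
has eigenvalue q. -/
theorem EE_smul (k : Fin 6) : EE q t • ε k = if (k : ℕ) < 3 then ε k else 0 := by
  have e0 := E_smul (H.sig_zero k) (H.cupcap_zero h k)
  have e2 := E_smul (H.sig_two k) (H.cupcap_two h k)
  rw [EE, mul_smul, e2, smul_comm, e0]
  have hb := E_scalar h (a := -q⁻¹) (u := 0) (by simp)
  have hc := E_scalar h (a := (t ^ 2)⁻¹ * q) (u := loopValue q t) (by simp)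
  fin_cases k <;> simp [alpha, beta] at hb hc ⊢ <;> simp [hb, hc]

theorem S_smul {y : K} (hy : y ≠ 0) (j : Fin 6) :
    S q t y • ε j = ∑ i : Fin 6, ((normFactor q t y)⁻¹ *
      (fusedGram q t y i j * weight q (t ^ 2) j)) • if (i : ℕ) < 3 then ε i else 0 := by
  have hq := h.q_ne
  have h1 : q⁻¹ ^ 2 * y ^ 2 ≠ 0 := by positivity
  have h2 : q ^ 2 * y ^ 2 ≠ 0 := by positivity
  rw [S, smul_assoc, mul_smul, mul_smul, mul_smul, mul_smul, H.R_one h h2]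
  simp only [Finset.smul_sum, smul_comm (R q t _ _), H.R_two h, H.R_zero h, H.R_one h h1,
    smul_comm (EE q t), H.EE_smul h, smul_smul]
  rw [Finset.sum_comm]
  refine Finset.sum_congr rfl fun i _ => ?_
  rw [← Finset.sum_smul]
  congr 1
  rw [fusedGram, Finset.sum_mul, Finset.mul_sum]
  exact Finset.sum_congr rfl fun k _ => by ring

end IsAdjointBasis

end Action

/-! ### Adapted basis, block form and genericity -/

section Main

variable {K : Type u} [Field K] {q t : K} {M : Type v} [AddCommGroup M] [Module K M]
  [Module (BMW4 q t) M] [IsScalarTower K (BMW4 q t) M] {ε : Module.Basis (Fin 6) K M}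

/-- The adapted vectors. -/
def adaptedFamily (q t : K) (ε : Fin 6 → M) : Fin 3 → M :=
  ![ε 0, ε 1, -(weight q (t ^ 2) 2)⁻¹ • ε 2]

/-- The matrix of the fused `R`-matrix in the adapted basis. -/
def fusedMatrix (q t y : K) : Matrix (Fin 3) (Fin 3) K :=
  let d := br q t y 0 0 2 * br q t y 1 0 (-2) * (cu q t y 1 1 (-1) / cu q t y 1 0 (-1))
  let e := br q t y 0 1 2 * br q t y 0 1 (-1) * br q t y 1 1 (-2) + d
  let f := br q t y 0 1 0 * br q t y 1 0 (-1) * cu q t y 1 0 0 * cu q t y 1 0 (-3)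
    / cu q t y 1 0 (-1) ^ 2
  !![d, e, c21 q t y;
     e, d, c21 q t y;
     f, f, c22 q t y]

/-- The columns of P are e_1 + e_2, e_3 and e_1 - e_2. The symmetric part has entries d + e = c_11
and 2f = c_12; the antisymmetric vector has eigenvalue d - e = c_33. -/
theorem fusedMatrix_mul_P (q t y : K) : fusedMatrix q t y * P K = P K * C q t y := by
  ext i j
  fin_cases i <;> fin_cases j <;>
    simp [fusedMatrix, P, C, c11, c12, c33, Matrix.mul_apply, Fin.sum_univ_three] <;> ring

theorem P_conj (h2 : (2 : K) ≠ 0) (q t y : K) :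
    (P K)⁻¹ * fusedMatrix q t y * P K = C q t y := by
  have hdet : IsUnit (P K).det := by
    rw [isUnit_iff_ne_zero]
    simp [P, Matrix.det_fin_three]
    norm_num [h2]
  rw [mul_assoc, fusedMatrix_mul_P, ← mul_assoc, Matrix.nonsing_inv_mul _ hdet, one_mul]

theorem IsAdjointBasis.S_smul_adapted (H : IsAdjointBasis q t ε) (h : Generic q (t ^ 2))
    {y : K} (hy : y ≠ 0) (hN : normFactor q t y ≠ 0) (j : Fin 3) :
    S q t y • adaptedFamily q t ε j = ∑ i, fusedMatrix q t y i j • adaptedFamily q t ε i := by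
  have ht : t ≠ 0 := fun h0 => h.Q_ne (by simp [h0])
  have hw := weight_ne h 2
  have key {a b : K} (hab : a = normFactor q t y * b) : (normFactor q t y)⁻¹ * a = b := by
    rw [hab, inv_mul_cancel_left₀ hN]
  have h00 := key (fusedGram_zero_zero h ht hy)
  have h01 := key (fusedGram_zero_one h ht hy)
  have h02 := key (fusedGram_zero_two h ht hy)
  have h20 := key (fusedGram_two_zero h ht hy)
  have h22 := key (fusedGram_two_two h ht hy)
  have w1 : weight q (t ^ 2) 1 = weight q (t ^ 2) 0 := weight_flip 0
  have f11 : fusedGram q t y 1 1 = fusedGram q t y 0 0 := fusedGram_flip q t y 0 0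
  have f10 : fusedGram q t y 1 0 = fusedGram q t y 0 1 := fusedGram_flip q t y 0 1
  have f12 : fusedGram q t y 1 2 = fusedGram q t y 0 2 := fusedGram_flip q t y 0 2
  have f21 : fusedGram q t y 2 1 = fusedGram q t y 2 0 := fusedGram_flip q t y 2 0
  -- Invariance under `flip` lets the five computed entries fill all nine places.
  have hF : fusedMatrix q t y =
      !![(normFactor q t y)⁻¹ * (fusedGram q t y 0 0 * weight q (t ^ 2) 0),
          (normFactor q t y)⁻¹ * (fusedGram q t y 0 1 * weight q (t ^ 2) 0),
          (normFactor q t y)⁻¹ * -fusedGram q t y 0 2;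
         (normFactor q t y)⁻¹ * (fusedGram q t y 0 1 * weight q (t ^ 2) 0),
          (normFactor q t y)⁻¹ * (fusedGram q t y 0 0 * weight q (t ^ 2) 0),
          (normFactor q t y)⁻¹ * -fusedGram q t y 0 2;
         (normFactor q t y)⁻¹ * (-weight q (t ^ 2) 2 *
            (fusedGram q t y 2 0 * weight q (t ^ 2) 0)),
          (normFactor q t y)⁻¹ * (-weight q (t ^ 2) 2 *
            (fusedGram q t y 2 0 * weight q (t ^ 2) 0)),
          (normFactor q t y)⁻¹ * (fusedGram q t y 2 2 * weight q (t ^ 2) 2)] := by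
    rw [← w1, h01, w1, h00, h02, h20, h22]
    rfl
  rw [hF]
  simp only [adaptedFamily, Fin.sum_univ_three]
  fin_cases j
  · simp [H.S_smul h hy, Fin.sum_univ_six, f10]
    match_scalars
    field_simp
  · simp [H.S_smul h hy, Fin.sum_univ_six, f11, f21, w1]
    match_scalars
    field_simp
  · simp [smul_comm (S q t y) _ (ε 2), H.S_smul h hy, Fin.sum_univ_six, f12]
    match_scalars <;> field_simp

theorem linearIndependent_adaptedFamily {M : Type v} [AddCommGroup M] [Module K M]
    (ε : Module.Basis (Fin 6) K M) (h : Generic q (t ^ 2)) :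
    LinearIndependent K (adaptedFamily q t ε) := by
  have hw := weight_ne h 2
  have h3 : LinearIndependent K (fun i : Fin 3 => ε (Fin.castLE (by norm_num) i)) :=
    ε.linearIndependent.comp _ (Fin.castLE_injective _)
  have hu := h3.units_smul ![1, 1, -(Units.mk0 _ hw)⁻¹]
  convert hu using 1
  ext i
  fin_cases i <;> simp [adaptedFamily, Units.smul_def]

theorem IsAdjointBasis.span_adaptedFamily (H : IsAdjointBasis q t ε) (h : Generic q (t ^ 2)) :
    Submodule.span K (Set.range (adaptedFamily q t ε)) = fusedSpace q t M := by
  have hw := weight_ne h 2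
  apply le_antisymm
  · refine Submodule.span_le.2 ?_
    rintro _ ⟨i, rfl⟩
    refine ⟨adaptedFamily q t ε i, ?_⟩
    change EE q t • adaptedFamily q t ε i = _
    fin_cases i <;> simp [adaptedFamily, H.EE_smul h, smul_comm (EE q t)]
  · have mem (i) : adaptedFamily q t ε i ∈ Submodule.span K (Set.range (adaptedFamily q t ε)) :=
      Submodule.subset_span ⟨i, rfl⟩
    rintro _ ⟨m, rfl⟩
    change EE q t • m ∈ _
    rw [← ε.sum_repr m, Finset.smul_sum]
    refine Submodule.sum_mem _ fun k _ => ?_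
    rw [smul_comm, H.EE_smul h]
    refine Submodule.smul_mem _ _ ?_
    have h2 : ε 2 = (-weight q (t ^ 2) 2) • adaptedFamily q t ε 2 := by
      simp [adaptedFamily, smul_smul, hw]
    have m2 := Submodule.smul_mem _ (-weight q (t ^ 2) 2) (mem 2)
    rw [← h2] at m2
    fin_cases k
    · exact mem 0
    · exact mem 1
    · exact m2
    all_goals simp

theorem IsAdjointBasis.exists_isAdapted (H : IsAdjointBasis q t ε) (h : Generic q (t ^ 2))
    (h2 : (2 : K) ≠ 0) :
    ∃ b : Module.Basis (Fin 3) K (fusedSpace q t M), IsAdapted q t M b ∧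
      ∀ y : K, y ≠ 0 → normFactor q t y ≠ 0 →
        (P K)⁻¹ * LinearMap.toMatrix b b (fusedAction q t M y) * P K = C q t y := by
  let b := (Module.Basis.span (linearIndependent_adaptedFamily ε h)).map
    (LinearEquiv.ofEq _ _ (H.span_adaptedFamily h))
  have hb (i) : (b i : M) = adaptedFamily q t ε i := by
    simp [b, Module.Basis.span_apply]
  refine ⟨b, ⟨?_, ?_, ?_, ?_, ?_, ?_⟩, fun y hy hN => ?_⟩
  any_goals rw [hb]; simp [adaptedFamily, smul_comm (cupcap q t _), H.cupcap_zero h, H.cupcap_two h]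
  have hB : fusedAction q t M y = Matrix.toLin b b (fusedMatrix q t y) := by
    refine b.ext fun j => Subtype.ext ?_
    rw [Matrix.toLin_self]
    change S q t y • (b j : M) = _
    rw [hb, H.S_smul_adapted h hy hN]
    simp [hb]
  rw [hB, LinearMap.toMatrix_toLin, P_conj h2]

theorem IsAdjointBasis.isAdjointComponent (H : IsAdjointBasis q t ε) (h : Generic q (t ^ 2))
    (hinj : Function.Injective (eigenSum q (t ^ 2))) : IsAdjointComponent q t M where
  simple := H.isSimpleModule h hinj
  truncation_ne_zero := by
    refine ⟨ε 0, ?_⟩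
    rw [H.cupcap_two h, Pi.single_eq_same, loopValue_eq_inv h]
    exact smul_ne_zero (inv_ne_zero (weight_ne h 1)) (ε.ne_zero 0)
  truncation_eq m := by
    rw [← ε.sum_repr m]
    simp only [Finset.smul_sum]
    refine Finset.sum_congr rfl fun k _ => ?_
    rw [smul_comm, smul_comm (_ * _) (ε.repr m k), mul_smul, mul_smul, H.cupcap_two h,
      smul_comm (sig q t 0), H.sig_zero, algebraMap_smul]
    by_cases hk : k = 0
    · subst hk
      simp [alpha, smul_smul, mul_comm]
    · simp [hk]

theorem c11_eq_c22_inv {y : K} : c11 q t y = c22 q t y⁻¹ := by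
  simp [c11, c22, br, cu]

/-- A polynomial with rational coefficients which is nonzero at some rational point does not vanish
at algebraically independent elements. -/
theorem ne_zero_of_aeval_eq [Algebra ℚ K] (hqt : AlgebraicIndependent ℚ ![q, t])
    (p : MvPolynomial (Fin 2) ℚ) (hp : MvPolynomial.eval ![2, 3] p ≠ 0) {x : K}
    (hx : MvPolynomial.aeval ![q, t] p = x) : x ≠ 0 := by
  rintro rfl
  have := (injective_iff_map_eq_zero _).1 hqt p hx
  exact hp (by rw [this, map_zero])

open MvPolynomial in
theorem generic_of_algebraicIndependent [Algebra ℚ K] (hqt : AlgebraicIndependent ℚ ![q, t]) :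
    Generic q (t ^ 2) where
  q_ne := ne_zero_of_aeval_eq hqt (X 0) (by norm_num) (by simp)
  Q_ne := ne_zero_of_aeval_eq hqt (X 1 ^ 2) (by norm_num) (by simp)
  sq_sub_one := ne_zero_of_aeval_eq hqt (X 0 ^ 2 - 1) (by norm_num) (by simp)
  sq_add_one := ne_zero_of_aeval_eq hqt (X 0 ^ 2 + 1) (by norm_num) (by simp)
  sub_one := ne_zero_of_aeval_eq hqt (X 1 ^ 2 - 1) (by norm_num) (by simp)
  add_one := ne_zero_of_aeval_eq hqt (X 1 ^ 2 + 1) (by norm_num) (by simp)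
  add_sq := ne_zero_of_aeval_eq hqt (X 1 ^ 2 + X 0 ^ 2) (by norm_num) (by simp)
  sub_sq := ne_zero_of_aeval_eq hqt (X 1 ^ 2 - X 0 ^ 2) (by norm_num) (by simp)
  mul_sq := ne_zero_of_aeval_eq hqt (X 0 ^ 2 * X 1 ^ 2 - 1) (by norm_num) (by simp)
  add_pow_six := ne_zero_of_aeval_eq hqt (X 1 ^ 2 + X 0 ^ 6) (by norm_num) (by simp)

open MvPolynomial in
-- Multiplied by q t², the values become polynomials in q and t. Algebraic independence turns an
-- equality of values into one of polynomials, excluded since their values at (2, 3) are distinct.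
theorem eigenSum_injective [Algebra ℚ K] (hqt : AlgebraicIndependent ℚ ![q, t]) :
    Function.Injective (eigenSum q (t ^ 2)) := by
  let p : Fin 6 → MvPolynomial (Fin 2) ℚ :=
    ![-X 1 ^ 2 + 2 * X 0 ^ 2, X 0 ^ 2 - 2 * X 1 ^ 2, -3 * X 1 ^ 2, -X 1 ^ 2 + 2 * X 0 ^ 2 * X 1 ^ 2,
      X 0 ^ 2 * X 1 ^ 2 - 2 * X 1 ^ 2, 3 * X 0 ^ 2 * X 1 ^ 2]
  have hg := generic_of_algebraicIndependent hqt
  have hq := hg.q_ne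
  have ht : t ≠ 0 := fun h0 => hg.Q_ne (by simp [h0])
  have hp (k) : aeval ![q, t] (p k) = q * t ^ 2 * eigenSum q (t ^ 2) k := by
    fin_cases k <;> simp [p, eigenSum, alpha, beta] <;> field_simp <;> ring
  intro i j hij
  have h1 : p i = p j := hqt (by rw [hp, hp, hij])
  have h2 := congrArg (MvPolynomial.eval ![(2 : ℚ), 3]) h1
  revert h2
  fin_cases i <;> fin_cases j <;> norm_num [p]

end Main

end BMWFusion

end

theorem mainTheorem2 {K : Type u} [Field K] [Algebra ℚ K] (q t : K)
    (hqt : AlgebraicIndependent ℚ ![q, t]) :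
    (∃ (M : Type u) (_ : AddCommGroup M) (_ : Module K M) (_ : Module (BMWFusion.BMW4 q t) M)
      (_ : IsScalarTower K (BMWFusion.BMW4 q t) M), BMWFusion.IsAdjointComponent q t M) ∧
    (∀ (M : Type v) [AddCommGroup M] [Module K M] [Module (BMWFusion.BMW4 q t) M]
      [IsScalarTower K (BMWFusion.BMW4 q t) M], BMWFusion.IsAdjointComponent q t M →
      ∃ b : Module.Basis (Fin 3) K (BMWFusion.fusedSpace q t M),
        BMWFusion.IsAdapted q t M b ∧
        ∀ y : K, y ≠ 0 → BMWFusion.normFactor q t y ≠ 0 →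
          (BMWFusion.P K)⁻¹ * LinearMap.toMatrix b b (BMWFusion.fusedAction q t M y)
            * BMWFusion.P K = BMWFusion.C q t y) ∧
    (∀ y : K, y ≠ 0 → BMWFusion.c11 q t y = BMWFusion.c22 q t y⁻¹) := by
  have hg := BMWFusion.generic_of_algebraicIndependent hqt
  have hinj := BMWFusion.eigenSum_injective hqt
  -- Needed because det P = 2 must be invertible.
  have hchar : CharZero K := algebraRat.charZero K
  refine ⟨?_, ?_, fun y _ => BMWFusion.c11_eq_c22_inv⟩
  · obtain ⟨M, _, _, _, _, ε, hε⟩ := BMWFusion.exists_isAdjointBasis hg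
    exact ⟨M, inferInstance, inferInstance, inferInstance, inferInstance,
      hε.isAdjointComponent hg hinj⟩
  · intro M _ _ _ _ hM
    obtain ⟨ε, hε⟩ := hM.exists_isAdjointBasis hg hinj
    exact hε.exists_isAdapted hg two_ne_zero
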